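/- A simple diagram $(\mathbf{w},n)$ is given by a word $\mathbf{w}$ in the letters $r,c$ and a natural number $n$, recursively: $(\emptyset,n)$ is the $n\times n$ square; $(c\mathbf{w},n)$ is obtained from $(\mathbf{w},n)$ by adding a column of $n$ boxes on the left whose bottommost box is in the bottommost row of $(\mathbf{w},n)$; and $(r\mathbf{w},n)$ is obtained from $(\mathbf{w},n)$ by adding a row of $n$ boxes at the bottom whose leftmost box is in the leftmost column of $(\mathbf{w},n)$. A border-strip is a connected skew shape containing no $2\times 2$ square, and $\mathrm{BSD}(\mathbf{w},n)$ is the set of partitions of the boxes of $(\mathbf{w},n)$ into border-strips with $n$ boxes each. Let $C_{\mathbf{w}}$ and $R_{\mathbf{w}}$ be the numbers of letters $c$ and $r$ in $\mathbf{w}$, and let $\mathrm{hor}(\mathbf{w})=C_{\mathbf{w}}-R_{\mathbf{w}}$. **Theorem.** Let $\mathbf{v}$ and $\mathbf{w}$ be words of length $k$ in the letters $r,c$ with $|\mathrm{hor}(\mathbf{v})|<|\mathrm{hor}(\mathbf{w})|$. Then \[ |\mathrm{BSD}(\mathbf{v},n)| < |\mathrm{BSD}(\mathbf{w},n)| \quad\text{for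 all sufficiently large } n. \] Moreover, as $n\to\infty$, \[ \frac{|\mathrm{BSD}(\mathbf{v},n)|-|\mathrm{BSD}(\mathbf{w},n)|}{(n-k)!}=O(n^{2k-1}). \] -/

import Mathlib

open Filter Asymptotics

namespace BorderStrip

/-- The alphabet of the words that parametrize simple diagrams: `r` (row) and `c` (column). -/
inductive Letter
  | r
  | c
deriving DecidableEq

/-- The number `C_w` of letters `c` in the word `w`. -/
def numC (w : List Letter) : ℕ := w.count Letter.c

/-- The number `R_w` of letters `r` in the word `w`. -/
def numR (w : List Letter) : ℕ := w.count Letter.r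

/-- `hor w = C_w - R_w`. -/
def hor (w : List Letter) : ℤ := (numC w : ℤ) - (numR w : ℤ)

/-- A box of the plane is a pair (row index, column index). Row indices grow downwards and
column indices grow to the right, as in Mathlib's `YoungDiagram`. -/
abbrev Box := ℤ × ℤ

/-- The simple diagram `(w, n)`. The `n × n` square occupies rows and columns `0, …, n - 1`, so the
leftmost column of `(w, n)` has index `-C_w` and its bottommost row has index `R_w + n - 1`.
* `(c w, n)`: a column of `n` boxes is added immediately to the left of `(w, n)`, its lowest box
  lying in the bottommost row of `(w, n)`.
* `(r w, n)`: a row of `n` boxes is added immediately below `(w, n)`, its leftmost box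
  lying in the leftmost column of `(w, n)`. -/
noncomputable def simpleDiagram : List Letter → ℕ → Finset Box
  | [], n => Finset.Ico (0 : ℤ) n ×ˢ Finset.Ico (0 : ℤ) n
  | Letter.c :: w, n => simpleDiagram w n ∪
      (Finset.Ico (numR w : ℤ) (numR w + n) ×ˢ {-(numC w : ℤ) - 1})
  | Letter.r :: w, n => simpleDiagram w n ∪
      ({(numR w : ℤ) + n} ×ˢ Finset.Ico (-(numC w : ℤ)) (-(numC w : ℤ) + n))

/-- A skew shape: a translate of the set of boxes of `lam / mu`, for Young diagrams
`mu ⊆ lam`. -/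
def IsSkewShape (S : Finset Box) : Prop :=
  ∃ (lam mu : YoungDiagram) (t : ℤ × ℤ), mu ≤ lam ∧
    S = (lam.cells \ mu.cells).image (fun x : ℕ × ℕ => ((x.1 : ℤ) + t.1, (x.2 : ℤ) + t.2))

/-- The graph on the boxes of the plane in which two boxes are adjacent when they share an edge. -/
def boxGraph : SimpleGraph Box where
  Adj x y := |x.1 - y.1| + |x.2 - y.2| = 1
  symm := ⟨fun x y h => by rw [abs_sub_comm y.1, abs_sub_comm y.2]; exact h⟩
  loopless := ⟨fun x h => by simp at h⟩

/-- A border-strip: a connected skew shape that contains no `2 × 2` square. -/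
structure IsBorderStrip (S : Finset Box) : Prop where
  skew : IsSkewShape S
  connected : (boxGraph.induce (S : Set Box)).Connected
  no_square : ¬ ∃ i j : ℤ, (i, j) ∈ S ∧ (i, j + 1) ∈ S ∧ (i + 1, j) ∈ S ∧ (i + 1, j + 1) ∈ S

/-- `BSD w n`: the set of border-strip decompositions of the simple diagram `(w, n)`, that is, of
the partitions of its set of boxes into border-strips with `n` boxes each. -/
def BSD (w : List Letter) (n : ℕ) : Set (Finpartition (simpleDiagram w n)) :=
  {P | ∀ S ∈ P.parts, IsBorderStrip S ∧ S.card = n}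

end BorderStrip

/-!
The proof turns decompositions into permutations and counts the permutations to second order.

A border-strip with `n` boxes has one box on each of `n` consecutive diagonals and moves up or right
from each diagonal to the next (`isBorderStrip_pathBoxes`, `IsBorderStrip.exists_pathBoxes`). Let
`k` be the length of the word. Comparing the lengths of the diagonals of `(w, n)` shows that exactly
one strip of a decomposition starts on each of the first `n + k` diagonals, which labels the strips
by `Fin (n + k)` (`exists_labelling`). Strips do not cross, so a decomposition amounts to a
consistent ordering of the strips that meet a common diagonal. Passing the letter number `t`,
strip `t` ends and strip `n + t` begins; the shape of the diagram demands that the new strip comes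
after the old one for a letter `c` and before it for a letter `r`.

A total order of all labels that respects the letters thus yields a decomposition, and every
decomposition arises so, but several orders may yield the same one, since strips `s` and `n + t`
with `s < t` share no diagonal. Placing each new strip as late as possible selects one
order: the orders that respect the letters and in which `n + t` is never immediately before `s` for
`s < t` are in bijection with the decompositions (`ncard_BSD`).

There are `(n + k)! / 2 ^ k` orders that respect the letters, whatever the word is. The orders in
which moreover `n + t` is immediately before `s` are counted by merging these two elements: their
number is `(n + k - 1)! / (6 * 2 ^ (k - 2))` if the letters `s` and `t` agree, and twice as much if
they differ (`ncard_adjacent_and_letterOrder`). Two such adjacencies at once occur in at most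
`(n + k - 2)!` orders. By a Bonferroni inequality, the number of decompositions is, up to
`O((n + k - 2)!)`, a quantity that depends on `n` and `k` only minus a positive multiple of
`(n + k - 1)!` that increases with the number of pairs of distinct letters. The latter is
`(k ^ 2 - hor w ^ 2) / 4` (`four_mul_pairWeight`), which gives the strict inequality; the bound on
the difference follows from `(n + k - 1)! ≤ (n - k)! * (2 * n) ^ (2 * k - 1)`.
-/

namespace BorderStrip

/-! ### Border-strips as lattice paths -/

/-- Skew shapes are exactly the finite order-convex sets of boxes. -/
lemma isSkewShape_iff_ordConnected (S : Finset Box) :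
    IsSkewShape S ↔ (S : Set Box).OrdConnected := by
  classical
  constructor
  · rintro ⟨lam, mu, t, -, rfl⟩
    refine ⟨fun x hx y hy z hz => ?_⟩
    simp only [Finset.coe_image, Set.mem_image, Finset.mem_coe, Finset.mem_sdiff,
      YoungDiagram.mem_cells] at hx hy ⊢
    obtain ⟨a, ⟨ha, ha'⟩, rfl⟩ := hx
    obtain ⟨b, ⟨hb, hb'⟩, rfl⟩ := hy
    obtain ⟨⟨h1, h2⟩, ⟨h3, h4⟩⟩ := hz
    dsimp only at h1 h2 h3 h4
    refine ⟨((z.1 - t.1).toNat, (z.2 - t.2).toNat), ⟨?_, ?_⟩, ?_⟩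
    · refine lam.isLowerSet ?_ hb
      exact ⟨by dsimp only; omega, by dsimp only; omega⟩
    · intro hz
      refine ha' (mu.isLowerSet ?_ hz)
      exact ⟨by dsimp only; omega, by dsimp only; omega⟩
    · ext <;> dsimp only <;> omega
  · intro h
    -- translate `S` into the first quadrant
    obtain ⟨t, ht⟩ : ∃ t : ℤ, ∀ x ∈ S, t ≤ x.1 ∧ t ≤ x.2 := by
      obtain ⟨m, hm⟩ := (S.image fun x => min x.1 x.2).bddBelow
      refine ⟨m, fun x hx => ?_⟩
      have := hm (Finset.mem_coe.2 (Finset.mem_image_of_mem (fun x : Box => min x.1 x.2) hx))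
      exact le_min_iff.1 this
    let f : ℕ × ℕ → Box := fun x => ((x.1 : ℤ) + t, (x.2 : ℤ) + t)
    have hf : ∀ x ∈ S, f ((x.1 - t).toNat, (x.2 - t).toNat) = x := fun x hx => by
      have := ht x hx
      ext <;> simp only [f] <;> omega
    have hfm : ∀ x y : ℕ × ℕ, x ≤ y → f x ≤ f y := fun x y hxy =>
      ⟨by have := hxy.1; simp only [f]; omega, by have := hxy.2; simp only [f]; omega⟩
    let g : Box → ℕ × ℕ := fun x => ((x.1 - t).toNat, (x.2 - t).toNat)
    let L : Finset (ℕ × ℕ) := S.biUnion fun x => Finset.Iic (g x)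
    have hL : ∀ z, z ∈ L ↔ ∃ x ∈ S, z ≤ g x := fun z => by simp [L]
    let lam : YoungDiagram := ⟨L, fun a b hba ha => by
      obtain ⟨x, hx, hax⟩ := (hL a).1 ha
      exact (hL b).2 ⟨x, hx, hba.trans hax⟩⟩
    let mu : YoungDiagram := ⟨L.filter fun z => f z ∉ S, fun a b hba ha => by
      simp only [Finset.coe_filter, Set.mem_ofPred_eq] at ha ⊢
      obtain ⟨x, hx, hax⟩ := (hL a).1 ha.1
      refine ⟨(hL b).2 ⟨x, hx, hba.trans hax⟩, fun hb => ha.2 ?_⟩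
      have h2 : f a ≤ x := by
        have := hfm _ _ hax
        rwa [hf x hx] at this
      exact h.out hb hx ⟨hfm _ _ hba, h2⟩⟩
    refine ⟨lam, mu, (t, t), fun z hz => (Finset.mem_filter.1 hz).1, ?_⟩
    ext x
    simp only [Finset.mem_image, Finset.mem_sdiff, lam, mu, Finset.mem_filter, not_and, not_not]
    constructor
    · intro hx
      refine ⟨g x, ⟨(hL _).2 ⟨x, hx, le_rfl⟩, fun _ => ?_⟩, hf x hx⟩
      have := hf x hx
      rw [show f (g x) = x from this]; exact hx
    · rintro ⟨a, ⟨ha, ha'⟩, rfl⟩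
      exact ha' ha

/-- The box of content `d` (column index minus row index) in column `j`. -/
def boxAt (d j : ℤ) : Box := (j - d, j)

lemma boxAt_content (b : Box) : boxAt (b.2 - b.1) b.2 = b := by
  ext <;> simp [boxAt]

@[simp] lemma boxAt_inj {d j d' j' : ℤ} : boxAt d j = boxAt d' j' ↔ d = d' ∧ j = j' := by
  simp only [boxAt, Prod.mk.injEq]; omega

/-- The set of boxes that has, for each content `d` in `[a, a + n)`, one box of content `d`,
lying in column `g d`. -/
noncomputable def pathBoxes (g : ℤ → ℤ) (a : ℤ) (n : ℕ) : Finset Box :=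
  (Finset.Ico a (a + n)).image fun d => boxAt d (g d)

lemma boxAt_mem_pathBoxes {g : ℤ → ℤ} {a : ℤ} {n : ℕ} {d j : ℤ} :
    boxAt d j ∈ pathBoxes g a n ↔ (a ≤ d ∧ d < a + n) ∧ g d = j := by
  simp [pathBoxes]

lemma card_pathBoxes (g : ℤ → ℤ) (a : ℤ) (n : ℕ) : (pathBoxes g a n).card = n := by
  rw [pathBoxes, Finset.card_image_of_injective]
  · simp
  · intro d d' h
    exact (boxAt_inj.1 h).1

/-- The path moves up (same column) or to the right (next column) at each step. -/
def IsStepping (g : ℤ → ℤ) (a : ℤ) (n : ℕ) : Prop :=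
  ∀ d, a ≤ d → d + 1 < a + n → g (d + 1) = g d ∨ g (d + 1) = g d + 1

lemma IsStepping.mono {g : ℤ → ℤ} {a : ℤ} {n : ℕ} (h : IsStepping g a n) {d e : ℤ}
    (hd : a ≤ d) (hde : d ≤ e) (he : e < a + n) : g d ≤ g e ∧ g e ≤ g d + (e - d) := by
  induction e, hde using Int.leInduction with
  | base => simp
  | succ e hde ih =>
    have := ih (by omega)
    have := h e (by omega) he
    omega

lemma isBorderStrip_pathBoxes {g : ℤ → ℤ} {a : ℤ} {n : ℕ} (hn : 0 < n) (h : IsStepping g a n) :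
    IsBorderStrip (pathBoxes g a n) := by
  refine ⟨?_, ?_, ?_⟩
  · rw [isSkewShape_iff_ordConnected]
    refine ⟨fun x hx y hy z hz => ?_⟩
    rw [← boxAt_content x, ← boxAt_content y, ← boxAt_content z] at *
    generalize x.2 = jx, x.2 - x.1 = dx, y.2 = jy, y.2 - y.1 = dy, z.2 = jz, z.2 - z.1 = dz at *
    rw [Finset.mem_coe, boxAt_mem_pathBoxes] at *
    obtain ⟨⟨h1, h2⟩, ⟨h3, h4⟩⟩ := hz
    dsimp only [boxAt] at h1 h2 h3 h4
    obtain ⟨⟨hx1, hx2⟩, rfl⟩ := hx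
    obtain ⟨⟨hy1, hy2⟩, rfl⟩ := hy
    -- by monotonicity the end boxes lie in a common row or in a common column
    rcases le_total dx dy with hd | hd
    · have e1 := h.mono hx1 hd hy2
      have e2 := h.mono (d := dx) (e := dz) hx1 (by omega) (by omega)
      have e3 := h.mono (d := dz) (e := dy) (by omega) (by omega) (by omega)
      omega
    · have e1 := h.mono hy1 hd hx2
      have e2 := h.mono (d := dy) (e := dz) hy1 (by omega) (by omega)
      have e3 := h.mono (d := dz) (e := dx) (by omega) (by omega) (by omega)
      omega
  · have hmem : ∀ d, a ≤ d → d < a + n → boxAt d (g d) ∈ pathBoxes g a n := fun d h1 h2 =>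
      boxAt_mem_pathBoxes.2 ⟨⟨h1, h2⟩, rfl⟩
    have key : ∀ d (hd : a ≤ d) (hd' : d < a + n),
        (boxGraph.induce (pathBoxes g a n : Set Box)).Reachable
          ⟨boxAt a (g a), hmem a le_rfl (by omega)⟩ ⟨boxAt d (g d), hmem d hd hd'⟩ := by
      intro d hd
      induction d, hd using Int.leInduction with
      | base => intro _; exact SimpleGraph.Reachable.refl _
      | succ d hd ih =>
        intro hd'
        refine (ih (by omega)).trans (SimpleGraph.Adj.reachable ?_)
        have := h d hd hd'
        simp only [SimpleGraph.comap_adj, Function.Embedding.subtype_apply, boxGraph, boxAt]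
        rcases this with e | e <;> rw [e]
        · simp
        · simp
    rw [SimpleGraph.connected_iff]
    have : ∀ x : (pathBoxes g a n : Set Box),
        (boxGraph.induce (pathBoxes g a n : Set Box)).Reachable
          ⟨boxAt a (g a), hmem a le_rfl (by omega)⟩ x := by
      rintro ⟨x, hx⟩
      have hx' := hx
      rw [← boxAt_content x, Finset.mem_coe, boxAt_mem_pathBoxes] at hx'
      have := key _ hx'.1.1 hx'.1.2
      convert this using 2
      rw [hx'.2, boxAt_content]
    exact ⟨fun x y => (this x).symm.trans (this y), ⟨⟨_, hmem a le_rfl (by omega)⟩⟩⟩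
  · rintro ⟨i, j, h1, -, -, h2⟩
    rw [← boxAt_content (i, j), boxAt_mem_pathBoxes] at h1
    rw [← boxAt_content (i + 1, j + 1), boxAt_mem_pathBoxes] at h2
    dsimp only at h1 h2
    have e : j + 1 - (i + 1) = j - i := by ring
    rw [e] at h2
    omega

/-- Along a walk from content at most `d` to content above `d` some edge joins content `d` to
content `d + 1`. -/
lemma exists_adj_content_of_walk {S : Set Box} (d : ℤ) {x y : S} (p : (boxGraph.induce S).Walk x y)
    (hx : x.1.2 - x.1.1 ≤ d) (hy : d < y.1.2 - y.1.1) :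
    ∃ u ∈ S, ∃ v ∈ S, u.2 - u.1 = d ∧ v.2 - v.1 = d + 1 ∧ (v.2 = u.2 ∨ v.2 = u.2 + 1) := by
  induction p with
  | nil => omega
  | @cons x z y hxz p ih =>
    by_cases hz : z.1.2 - z.1.1 ≤ d
    · exact ih hz hy
    · have hadj : |x.1.1 - z.1.1| + |x.1.2 - z.1.2| = 1 := hxz
      refine ⟨x.1, x.2, z.1, z.2, ?_, ?_, ?_⟩ <;>
      · rcases abs_cases (x.1.1 - z.1.1) with h | h <;>
        rcases abs_cases (x.1.2 - z.1.2) with h' | h' <;> omega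

/-- In a border-strip, distinct boxes have distinct contents: by convexity, two boxes on one
diagonal would produce a `2 × 2` square. -/
lemma IsBorderStrip.content_injOn {S : Finset Box} (h : IsBorderStrip S) {x y : Box} (hx : x ∈ S)
    (hy : y ∈ S) (hxy : x.2 - x.1 = y.2 - y.1) : x = y := by
  wlog hle : x.1 ≤ y.1 generalizing x y
  · exact (this hy hx hxy.symm (by omega)).symm
  by_contra hne
  have hlt : x.1 < y.1 := by
    refine lt_of_le_of_ne hle fun he => hne (Prod.ext he (by omega))
  have hc := (isSkewShape_iff_ordConnected S).1 h.skew
  refine h.no_square ⟨x.1, x.2, hx, ?_, ?_, ?_⟩ <;>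
  exact hc.out hx hy ⟨⟨by dsimp only; omega, by dsimp only; omega⟩,
    ⟨by dsimp only; omega, by dsimp only; omega⟩⟩

lemma IsBorderStrip.exists_pathBoxes {S : Finset Box} (h : IsBorderStrip S) {n : ℕ}
    (hn : S.card = n) : ∃ g a, IsStepping g a n ∧ S = pathBoxes g a n := by
  classical
  have hinj : Set.InjOn (fun b : Box => b.2 - b.1) S := fun x hx y hy => h.content_injOn hx hy
  set C := S.image fun b : Box => b.2 - b.1 with hC
  have hne : S.Nonempty := by
    obtain ⟨x⟩ := h.connected.nonempty
    exact ⟨x.1, x.2⟩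
  have hCne : C.Nonempty := hne.image _
  have hcross : ∀ d, C.min' hCne ≤ d → d < C.max' hCne →
      ∃ u ∈ S, ∃ v ∈ S, u.2 - u.1 = d ∧ v.2 - v.1 = d + 1 ∧ (v.2 = u.2 ∨ v.2 = u.2 + 1) := by
    intro d h1 h2
    obtain ⟨x, hx, hx'⟩ := Finset.mem_image.1 (C.min'_mem hCne)
    obtain ⟨y, hy, hy'⟩ := Finset.mem_image.1 (C.max'_mem hCne)
    obtain ⟨p⟩ := h.connected.preconnected ⟨x, hx⟩ ⟨y, hy⟩
    exact exists_adj_content_of_walk d p (by dsimp only at hx' ⊢; omega)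
      (by dsimp only at hy' ⊢; omega)
  have hCeq : C = Finset.Icc (C.min' hCne) (C.max' hCne) := by
    ext d
    refine ⟨fun hd => Finset.mem_Icc.2 ⟨C.min'_le _ hd, C.le_max' _ hd⟩, fun hd => ?_⟩
    obtain ⟨h1, h2⟩ := Finset.mem_Icc.1 hd
    rcases h2.eq_or_lt with h2 | h2
    · rw [h2]; exact C.max'_mem _
    · obtain ⟨u, hu, -, -, hu', -⟩ := hcross d h1 h2
      exact Finset.mem_image.2 ⟨u, hu, hu'⟩
  generalize C.min' hCne = a at *
  generalize C.max' hCne = m at *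
  have hcard : C.card = n := by rw [hC, Finset.card_image_of_injOn hinj, hn]
  have hm : m + 1 = a + n := by
    have hpos := Finset.card_pos.2 hCne
    rw [hCeq, Int.card_Icc] at hcard hpos
    omega
  have hex : ∀ d ∈ C, ∃ j, boxAt d j ∈ S := by
    intro d hd
    obtain ⟨x, hx, rfl⟩ := Finset.mem_image.1 hd
    exact ⟨x.2, by rwa [boxAt_content]⟩
  choose! g hg using hex
  have hg' : ∀ x ∈ S, g (x.2 - x.1) = x.2 := by
    intro x hx
    have := hg _ (Finset.mem_image_of_mem (fun b : Box => b.2 - b.1) hx)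
    exact congrArg Prod.snd (h.content_injOn this hx (by simp [boxAt]))
  refine ⟨g, a, ?_, ?_⟩
  · intro d h1 h2
    obtain ⟨u, hu, v, hv, hu', hv', hor⟩ := hcross d h1 (by omega)
    have e1 := hg' u hu
    have e2 := hg' v hv
    rw [hu'] at e1
    rw [hv'] at e2
    rw [e1, e2]; exact hor
  · ext x
    rw [← boxAt_content x, boxAt_mem_pathBoxes, boxAt_content]
    constructor
    · intro hx
      have : x.2 - x.1 ∈ C := Finset.mem_image_of_mem (fun b : Box => b.2 - b.1) hx
      refine ⟨?_, hg' x hx⟩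
      rw [hCeq, Finset.mem_Icc] at this
      omega
    · rintro ⟨h1, h2⟩
      have : x.2 - x.1 ∈ C := by rw [hCeq, Finset.mem_Icc]; omega
      have := hg _ this
      rwa [h2, boxAt_content] at this

/-! ### The diagonals of a simple diagram -/

/-- The leftmost column met by the diagonal of content `d` in the diagram `(w, n)`. Each letter `c`
moves it by `-1` for the contents up to that of the topmost box of the column which the letter
adds. -/
def leftCol (w : List Letter) (d : ℤ) : ℤ :=
  max d 0 - numC (w.drop (w.length - (-d).toNat))

lemma leftCol_of_le {w : List Letter} {d : ℤ} (h : d ≤ -w.length) : leftCol w d = -numC w := by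
  have : w.length - (-d).toNat = 0 := by omega
  rw [leftCol, this, List.drop_zero]
  omega

lemma leftCol_of_nonneg {w : List Letter} {d : ℤ} (h : 0 ≤ d) : leftCol w d = d := by
  have : w.length - (-d).toNat = w.length := by omega
  rw [leftCol, this, List.drop_length]
  simp [numC, h]

lemma leftCol_cons {a : Letter} {w : List Letter} {d : ℤ} (h : -(w.length : ℤ) ≤ d) :
    leftCol (a :: w) d = leftCol w d := by
  have : (a :: w).length - (-d).toNat = (w.length - (-d).toNat) + 1 := by
    simp only [List.length_cons]; omega
  rw [leftCol, this, List.drop_succ_cons, leftCol]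

lemma leftCol_succ_of_letter {w : List Letter} {t : ℕ} (ht : t < w.length) {d : ℤ}
    (hd : d = t - w.length) :
    leftCol w (d + 1) = leftCol w d + if w[t] = Letter.c then 1 else 0 := by
  have h1 : w.length - (-d).toNat = t := by omega
  have h2 : w.length - (-(d + 1)).toNat = t + 1 := by omega
  rw [leftCol, leftCol, h1, h2, List.drop_eq_getElem_cons ht, numC, numC, List.count_cons]
  simp only [beq_iff_eq]
  split_ifs <;> push_cast <;> omega

lemma numC_add_numR (w : List Letter) : numC w + numR w = w.length := by
  induction w with
  | nil => rfl
  | cons a w ih =>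
    cases a <;> simp [numC, numR] at ih ⊢ <;> omega

/-- The diagonal of content `d` of the diagram `(w, n)` consists of consecutive boxes, starting in
column `leftCol w d`. -/
lemma boxAt_mem_simpleDiagram {w : List Letter} {n : ℕ} (d j : ℤ) :
    boxAt d j ∈ simpleDiagram w n ↔
      leftCol w d ≤ j ∧ j < leftCol w d + (n - max d 0 - max (-d - w.length) 0) := by
  induction w with
  | nil =>
    have : leftCol [] d = max d 0 := by simp [leftCol, numC]
    rw [this]
    simp only [simpleDiagram, boxAt, Finset.mem_product, Finset.mem_Ico, List.length_nil]
    omega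
  | cons a w ih =>
    have hl := numC_add_numR w
    rcases le_or_gt (-(w.length : ℤ)) d with h | h
    · rw [leftCol_cons h]
      have : boxAt d j ∈ simpleDiagram (a :: w) n ↔ boxAt d j ∈ simpleDiagram w n := by
        cases a <;>
        · simp only [simpleDiagram, Finset.mem_union, boxAt, Finset.mem_product,
            Finset.mem_Ico, Finset.mem_singleton]
          refine or_iff_left ?_
          omega
      rw [this, ih]
      simp only [List.length_cons]
      omega
    · rw [leftCol_of_le h.le] at ih
      rw [leftCol_of_le (by simp only [List.length_cons]; omega)]
      have h0 : (max d 0) = 0 := by omega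
      rw [h0, max_eq_left (by omega)] at ih
      rw [h0, max_eq_left (by simp only [List.length_cons]; omega)]
      cases a
      · have : numC (Letter.r :: w) = numC w := by simp [numC]
        simp only [simpleDiagram, Finset.mem_union, ih, this]
        simp only [boxAt, Finset.mem_product, Finset.mem_Ico, Finset.mem_singleton,
          List.length_cons]
        omega
      · have : numC (Letter.c :: w) = numC w + 1 := by simp [numC]
        simp only [simpleDiagram, Finset.mem_union, ih, this]
        simp only [boxAt, Finset.mem_product, Finset.mem_Ico, Finset.mem_singleton,
          List.length_cons]
        omega

/-- The strip with label `a` (of which there are `n + k`) has its boxes of contents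
`a - n - k + 1, …, a - k`; `Active n k d a` says that it meets the diagonal of content `d`. -/
def Active (n k : ℕ) (d : ℤ) (a : Fin (n + k)) : Prop :=
  (a : ℤ) - n - k + 1 ≤ d ∧ d < (a : ℤ) - k + 1

instance (n k : ℕ) (d : ℤ) : DecidablePred (Active n k d) := fun _ =>
  inferInstanceAs (Decidable (_ ∧ _))

lemma card_active (n k : ℕ) (d : ℤ) :
    (Finset.univ.filter (Active n k d)).card = (n - max d 0 - max (-d - k) 0).toNat := by
  have : (Finset.univ.filter (Active n k d)).card =
      (Finset.Icc (max 0 (d + k)) (min (n + k - 1 : ℤ) (d + n + k - 1))).card := by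
    refine Finset.card_bij' (fun a _ => (a : ℤ)) (fun z hz => ⟨z.toNat, ?_⟩) ?_ ?_ ?_ ?_
    · rw [Finset.mem_Icc] at hz; omega
    · intro a ha
      obtain ⟨h1, h2⟩ := (Finset.mem_filter.1 ha).2
      rw [Finset.mem_Icc]; omega
    · intro z hz
      rw [Finset.mem_Icc] at hz
      refine Finset.mem_filter.2 ⟨Finset.mem_univ _, ?_, ?_⟩ <;> dsimp only <;> omega
    · intro a ha; simp
    · intro z hz
      rw [Finset.mem_Icc] at hz; dsimp only; omega
  rw [this, Int.card_Icc]; omega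

lemma boxAt_mem_simpleDiagram_iff_card_active {w : List Letter} {n k : ℕ} (hw : w.length = k)
    (d j : ℤ) : boxAt d j ∈ simpleDiagram w n ↔
      leftCol w d ≤ j ∧ j < leftCol w d + (Finset.univ.filter (Active n k d)).card := by
  rw [boxAt_mem_simpleDiagram, card_active, hw]
  omega

/-- Passing from one diagonal to the next, at most one strip ends and at most one begins. -/
lemma card_active_succ {n k : ℕ} (hn : 0 < n) (d : ℤ) (Q : Fin (n + k) → Prop) [DecidablePred Q] :
    (Finset.univ.filter fun a => Active n k (d + 1) a ∧ Q a).card +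
      (Finset.univ.filter fun a : Fin (n + k) => (a : ℤ) = d + k ∧ Q a).card =
    (Finset.univ.filter fun a => Active n k d a ∧ Q a).card +
      (Finset.univ.filter fun a : Fin (n + k) => (a : ℤ) = d + n + k ∧ Q a).card := by
  rw [← Finset.card_union_of_disjoint, ← Finset.card_union_of_disjoint]
  · congr 1
    ext a
    simp only [Finset.mem_union, Finset.mem_filter, Finset.mem_univ, true_and, ← or_and_right]
    refine and_congr_left fun _ => ?_
    simp only [Active]; omega
  all_goals
    refine Finset.disjoint_left.2 fun a ha hb => ?_
    obtain ⟨⟨h1, h2⟩, -⟩ := (Finset.mem_filter.1 ha).2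
    obtain ⟨h3, -⟩ := (Finset.mem_filter.1 hb).2
    omega

lemma card_filter_eq_and {m : ℕ} (z : ℤ) (a : Fin m) (ha : (a : ℤ) = z) (Q : Fin m → Prop)
    [DecidablePred Q] :
    (Finset.univ.filter fun b : Fin m => (b : ℤ) = z ∧ Q b).card = if Q a then 1 else 0 := by
  have : (Finset.univ.filter fun b : Fin m => (b : ℤ) = z ∧ Q b) =
      if Q a then {a} else ∅ := by
    ext b
    simp only [Finset.mem_filter, Finset.mem_univ, true_and]
    split_ifs with h
    · rw [Finset.mem_singleton, Fin.ext_iff]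
      constructor
      · rintro ⟨h1, -⟩; omega
      · intro h1; rw [show b = a from Fin.ext h1]; exact ⟨ha, h⟩
    · simp only [Finset.notMem_empty, iff_false, not_and]
      intro h1
      rwa [show b = a from Fin.ext (by omega)]
  rw [this]; split_ifs <;> simp

lemma card_filter_eq_and_of_lt {m : ℕ} (z : ℤ) (hz : z < 0 ∨ m ≤ z) (Q : Fin m → Prop)
    [DecidablePred Q] :
    (Finset.univ.filter fun b : Fin m => (b : ℤ) = z ∧ Q b).card = 0 := by
  rw [Finset.card_eq_zero, Finset.filter_eq_empty_iff]
  intro b _ h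
  omega

/-! ### From orders of the strips to decompositions -/

section Rank

variable {n k : ℕ} {α : Type*} [LinearOrder α]

/-- The position of strip `a` on the diagonal of content `d` when the strips that meet this diagonal
are sorted by `f`. -/
def rank (n k : ℕ) (f : Fin (n + k) → α) (d : ℤ) (a : Fin (n + k)) : ℕ :=
  (Finset.univ.filter fun b => Active n k d b ∧ f b < f a).card

lemma rank_le_rank (f : Fin (n + k) → α) (d : ℤ) {a b : Fin (n + k)} (h : f a ≤ f b) :
    rank n k f d a ≤ rank n k f d b :=
  Finset.card_le_card fun c hc => by
    simp only [Finset.mem_filter, Finset.mem_univ, true_and] at hc ⊢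
    exact ⟨hc.1, hc.2.trans_le h⟩

lemma rank_lt_rank {f : Fin (n + k) → α} {d : ℤ} {a b : Fin (n + k)} (ha : Active n k d a)
    (h : f a < f b) : rank n k f d a < rank n k f d b := by
  refine Finset.card_lt_card (Finset.ssubset_iff_of_subset ?_ |>.2 ⟨a, ?_, ?_⟩)
  · intro c hc
    simp only [Finset.mem_filter, Finset.mem_univ, true_and] at hc ⊢
    exact ⟨hc.1, hc.2.trans h⟩
  · simp [ha, h]
  · simp

lemma rank_lt_rank_iff {f : Fin (n + k) → α} {d : ℤ} {a b : Fin (n + k)} (ha : Active n k d a) :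
    rank n k f d a < rank n k f d b ↔ f a < f b :=
  ⟨fun h => lt_of_not_ge fun h' => absurd (rank_le_rank f d h') (by omega), rank_lt_rank ha⟩

lemma rank_lt_card (f : Fin (n + k) → α) {d : ℤ} {a : Fin (n + k)} (ha : Active n k d a) :
    rank n k f d a < (Finset.univ.filter (Active n k d)).card := by
  refine Finset.card_lt_card (Finset.ssubset_iff_of_subset ?_ |>.2 ⟨a, ?_, ?_⟩)
  · intro c hc
    simp only [Finset.mem_filter, Finset.mem_univ, true_and] at hc ⊢
    exact hc.1
  · simp [ha]
  · simp

lemma rank_injOn {f : Fin (n + k) → α} {d : ℤ} (hf : Set.InjOn f {a | Active n k d a}) :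
    Set.InjOn (rank n k f d) {a | Active n k d a} := by
  intro a ha b hb h
  refine hf ha hb ?_
  rcases lt_trichotomy (f a) (f b) with h' | h' | h'
  · exact absurd (rank_lt_rank ha h') (by omega)
  · exact h'
  · exact absurd (rank_lt_rank hb h') (by omega)

lemma exists_rank_eq {f : Fin (n + k) → α} {d : ℤ} (hf : Set.InjOn f {a | Active n k d a}) {p : ℕ}
    (hp : p < (Finset.univ.filter (Active n k d)).card) :
    ∃ a, Active n k d a ∧ rank n k f d a = p := by
  have h := Finset.surjOn_of_injOn_of_card_le (s := Finset.univ.filter (Active n k d))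
    (t := Finset.range (Finset.univ.filter (Active n k d)).card) (rank n k f d)
    (fun a ha => by
      simpa using rank_lt_card f (by simpa using ha))
    (fun a ha b hb => rank_injOn hf (by simpa using ha) (by simpa using hb)) (by simp)
  obtain ⟨a, ha, h⟩ := h (a := p) (by simpa using hp)
  exact ⟨a, by simpa using ha, h⟩

/-- An injection of the strips on a diagonal into an interval of the right length is given by the
ranks. -/
lemma eq_add_rank {f : Fin (n + k) → ℤ} {d L : ℤ} (hf : Set.InjOn f {a | Active n k d a})
    (hL : ∀ a, Active n k d a →
      L ≤ f a ∧ f a < L + (Finset.univ.filter (Active n k d)).card)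
    {a : Fin (n + k)} (ha : Active n k d a) : f a = L + rank n k f d a := by
  have hs := Finset.surjOn_of_injOn_of_card_le (s := Finset.univ.filter (Active n k d))
    (t := Finset.Ico L (L + (Finset.univ.filter (Active n k d)).card)) f
    (fun a ha => by
      have := hL a (by simpa using ha)
      simpa using this)
    (fun a ha b hb => hf (by simpa using ha) (by simpa using hb)) (by simp)
  have : rank n k f d a = (Finset.Ico L (f a)).card := by
    rw [rank, ← Finset.card_image_of_injOn (f := f)]
    · congr 1
      ext z
      simp only [Finset.mem_image, Finset.mem_filter, Finset.mem_univ, true_and, Finset.mem_Ico]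
      constructor
      · rintro ⟨b, ⟨hb, hba⟩, rfl⟩
        exact ⟨(hL b hb).1, hba⟩
      · rintro ⟨h1, h2⟩
        obtain ⟨b, hb, rfl⟩ := hs (a := z) (by
          have := hL a ha
          simp only [Finset.coe_Ico, Set.mem_Ico]; omega)
        exact ⟨b, ⟨by simpa using hb, h2⟩, rfl⟩
    · intro b hb c hc h
      simp only [Finset.coe_filter, Finset.mem_univ, true_and, Set.mem_ofPred_eq] at hb hc
      exact hf hb.1 hc.1 h
  have h0 := (hL a ha).1
  rw [this, Int.card_Ico]; omega

end Rank

/-- The strip that ends where the letter number `t` of the word is passed. -/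
def oldStrip (n : ℕ) {k : ℕ} (t : Fin k) : Fin (n + k) := Fin.castLE (Nat.le_add_left k n) t

/-- The strip that begins where the letter number `t` of the word is passed. -/
def newStrip (n : ℕ) {k : ℕ} (t : Fin k) : Fin (n + k) := Fin.natAdd n t

@[simp] lemma val_oldStrip (n : ℕ) {k : ℕ} (t : Fin k) : (oldStrip n t : ℕ) = t := rfl

@[simp] lemma val_newStrip (n : ℕ) {k : ℕ} (t : Fin k) : (newStrip n t : ℕ) = n + t := rfl

/-- The order of two elements that a letter prescribes: increasing for `c`, decreasing for `r`. -/
abbrev LetterOrder {α : Type*} [LT α] (l : Letter) (p q : α) : Prop :=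
  (l = Letter.c → p < q) ∧ (l = Letter.r → q < p)

/-- For each letter of the word, the strip that ends there precedes the strip that begins there if
the letter is `c`, and follows it if the letter is `r`. -/
def RespectsLetters {n k : ℕ} (u : Fin k → Letter) (σ : Equiv.Perm (Fin (n + k))) : Prop :=
  ∀ t, LetterOrder (u t) (σ (oldStrip n t)) (σ (newStrip n t))

/-- `newStrip t` is never immediately before `oldStrip s` with `s < t`. Such strips share no
diagonal, so that their order is not visible in the decomposition; this condition selects one order
among those that yield the same decomposition. -/
def IsCanonical {n k : ℕ} (σ : Equiv.Perm (Fin (n + k))) : Prop :=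
  ∀ s t : Fin k, s < t → (σ (oldStrip n s) : ℕ) ≠ σ (newStrip n t) + 1

/-- The column of strip `a` on the diagonal of content `d` when the strips are sorted by `σ`. -/
def stripCol (w : List Letter) (n : ℕ) (σ : Equiv.Perm (Fin (n + w.length)))
    (a : Fin (n + w.length)) (d : ℤ) : ℤ :=
  leftCol w d + rank n w.length σ d a

/-- The content of the first box of strip `a`. -/
def startContent {n k : ℕ} (a : Fin (n + k)) : ℤ := (a : ℤ) - n - k + 1

lemma active_iff {n k : ℕ} {a : Fin (n + k)} {d : ℤ} :
    Active n k d a ↔ startContent a ≤ d ∧ d < startContent a + n := by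
  simp only [Active, startContent]; omega

lemma isStepping_stripCol {w : List Letter} {n : ℕ} (hn : 0 < n)
    {σ : Equiv.Perm (Fin (n + w.length))} (hσ : RespectsLetters w.get σ)
    (a : Fin (n + w.length)) : IsStepping (stripCol w n σ a) (startContent a) n := by
  intro d _ _
  have h := card_active_succ (k := w.length) hn d fun b => σ b < σ a
  change rank n w.length σ (d + 1) a + _ = rank n w.length σ d a + _ at h
  have hle : ∀ z : ℤ, (Finset.univ.filter fun b : Fin (n + w.length) =>
      (b : ℤ) = z ∧ σ b < σ a).card ≤ 1 := fun z => Finset.card_le_one.2 fun b hb c hc => by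
    simp only [Finset.mem_filter, Finset.mem_univ, true_and] at hb hc
    exact Fin.ext (by omega)
  simp only [stripCol]
  rcases lt_or_ge d (-(w.length : ℤ)) with h1 | h1
  · rw [card_filter_eq_and_of_lt (d + w.length) (Or.inl (by omega))] at h
    rw [leftCol_of_le (d := d) (by omega), leftCol_of_le (d := d + 1) (by omega)]
    have := hle (d + n + w.length)
    omega
  rcases lt_or_ge d 0 with h2 | h2
  · obtain ⟨t, ht⟩ : ∃ t : Fin w.length, d = t - w.length :=
      ⟨⟨(d + w.length).toNat, by omega⟩, by simp only; omega⟩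
    rw [card_filter_eq_and (d + w.length) (oldStrip n t) (by rw [val_oldStrip]; omega),
      card_filter_eq_and (d + n + w.length) (newStrip n t)
        (by rw [val_newStrip]; omega)] at h
    rw [leftCol_succ_of_letter t.2 ht]
    have hc := hσ t
    rw [List.get_eq_getElem] at hc
    cases hu : w[(t : ℕ)]
    · have := hc.2 hu
      simp only [reduceCtorEq, if_false]
      split_ifs at h with h3 h4 h4 <;> omega
    · have := hc.1 hu
      simp only [if_true]
      split_ifs at h with h3 h4 h4 <;> omega
  · rw [card_filter_eq_and_of_lt (d + n + w.length) (Or.inr (by omega))] at h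
    rw [leftCol_of_nonneg h2, leftCol_of_nonneg (d := d + 1) (by omega)]
    have := hle (d + w.length)
    omega

/-- The boxes of strip `a` when the strips are sorted by `σ`. -/
noncomputable def strip (w : List Letter) (n : ℕ) (σ : Equiv.Perm (Fin (n + w.length)))
    (a : Fin (n + w.length)) : Finset Box :=
  pathBoxes (stripCol w n σ a) (startContent a) n

lemma boxAt_mem_strip {w : List Letter} {n : ℕ} {σ : Equiv.Perm (Fin (n + w.length))}
    {a : Fin (n + w.length)} {d j : ℤ} :
    boxAt d j ∈ strip w n σ a ↔ Active n w.length d a ∧ stripCol w n σ a d = j := by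
  rw [strip, boxAt_mem_pathBoxes, active_iff]

lemma strip_subset (w : List Letter) (n : ℕ) (σ : Equiv.Perm (Fin (n + w.length)))
    (a : Fin (n + w.length)) : strip w n σ a ⊆ simpleDiagram w n := by
  intro b hb
  rw [← boxAt_content b] at hb ⊢
  rw [boxAt_mem_strip] at hb
  have := rank_lt_card σ hb.1
  have h := hb.2
  rw [stripCol] at h
  rw [boxAt_mem_simpleDiagram_iff_card_active rfl]
  omega

lemma exists_mem_strip {w : List Letter} {n : ℕ} (σ : Equiv.Perm (Fin (n + w.length))) {b : Box}
    (hb : b ∈ simpleDiagram w n) : ∃ a, b ∈ strip w n σ a := by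
  rw [← boxAt_content b] at hb ⊢
  rw [boxAt_mem_simpleDiagram_iff_card_active rfl] at hb
  obtain ⟨a, ha, h⟩ := exists_rank_eq (n := n) (k := w.length) (f := σ)
    (d := b.2 - b.1) (p := (b.2 - leftCol w (b.2 - b.1)).toNat) σ.injective.injOn (by omega)
  refine ⟨a, boxAt_mem_strip.2 ⟨ha, ?_⟩⟩
  rw [stripCol, h]; omega

lemma eq_of_mem_strip {w : List Letter} {n : ℕ} {σ : Equiv.Perm (Fin (n + w.length))} {b : Box}
    {a a' : Fin (n + w.length)} (h : b ∈ strip w n σ a) (h' : b ∈ strip w n σ a') : a = a' := by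
  rw [← boxAt_content b, boxAt_mem_strip] at h h'
  refine rank_injOn (f := σ) σ.injective.injOn h.1 h'.1 ?_
  have := h.2.trans h'.2.symm
  simp only [stripCol] at this
  omega

/-- The decomposition of `(w, n)` whose strips are sorted by `σ` on every diagonal. -/
noncomputable def decomposition (w : List Letter) {n : ℕ} (hn : 0 < n)
    (σ : Equiv.Perm (Fin (n + w.length))) : Finpartition (simpleDiagram w n) :=
  Finpartition.ofExistsUnique (Finset.univ.image (strip w n σ))
    (fun p hp => by
      obtain ⟨a, -, rfl⟩ := Finset.mem_image.1 hp
      exact strip_subset w n σ a)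
    (fun b hb => by
      obtain ⟨a, ha⟩ := exists_mem_strip σ hb
      refine ⟨strip w n σ a, ⟨Finset.mem_image_of_mem _ (Finset.mem_univ a), ha⟩, ?_⟩
      rintro p ⟨hp, hbp⟩
      obtain ⟨a', -, rfl⟩ := Finset.mem_image.1 hp
      rw [eq_of_mem_strip ha hbp])
    (fun h => by
      obtain ⟨a, -, h⟩ := Finset.mem_image.1 h
      have := card_pathBoxes (stripCol w n σ a) (startContent a) n
      rw [← strip, h, Finset.card_empty] at this
      omega)

lemma mem_parts_decomposition {w : List Letter} {n : ℕ} (hn : 0 < n)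
    {σ : Equiv.Perm (Fin (n + w.length))} {S : Finset Box} :
    S ∈ (decomposition w hn σ).parts ↔ ∃ a, strip w n σ a = S := by
  change S ∈ Finset.univ.image (strip w n σ) ↔ _
  simp

lemma decomposition_mem_BSD {w : List Letter} {n : ℕ} (hn : 0 < n)
    {σ : Equiv.Perm (Fin (n + w.length))} (hσ : RespectsLetters w.get σ) :
    decomposition w hn σ ∈ BSD w n := by
  intro S hS
  obtain ⟨a, rfl⟩ := (mem_parts_decomposition hn).1 hS
  exact ⟨isBorderStrip_pathBoxes hn (isStepping_stripCol hn hσ a), card_pathBoxes _ _ _⟩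

/-- Equality of decompositions means that the two permutations order in the same way any two strips
that meet a common diagonal. -/
lemma lt_iff_lt_of_decomposition_eq {w : List Letter} {n : ℕ} (hn : 0 < n)
    {σ τ : Equiv.Perm (Fin (n + w.length))} (h : decomposition w hn σ = decomposition w hn τ)
    {a b : Fin (n + w.length)} {d : ℤ} (ha : Active n w.length d a) (hb : Active n w.length d b) :
    σ a < σ b ↔ τ a < τ b := by
  have key : ∀ a, strip w n σ a = strip w n τ a := by
    intro a
    have : strip w n σ a ∈ (decomposition w hn τ).parts := by
      rw [← h, mem_parts_decomposition]; exact ⟨a, rfl⟩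
    obtain ⟨a', ha'⟩ := (mem_parts_decomposition hn).1 this
    -- a strip determines its label: compare the ranges of contents
    have hmem : ∀ d j, (Active n w.length d a ∧ stripCol w n σ a d = j) ↔
        (Active n w.length d a' ∧ stripCol w n τ a' d = j) := fun d j => by
      rw [← boxAt_mem_strip, ← boxAt_mem_strip, ha']
    have h1 := ((hmem (startContent a) _).1 ⟨active_iff.2 (by omega), rfl⟩).1
    have h2 := ((hmem (startContent a') _).2 ⟨active_iff.2 (by omega), rfl⟩).1
    rw [active_iff] at h1 h2
    have : a = a' := by
      simp only [startContent] at h1 h2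
      exact Fin.ext (by omega)
    rw [← ha', this]
  have hrank : ∀ a, Active n w.length d a → rank n w.length σ d a = rank n w.length τ d a := by
    intro a ha
    have h1 : boxAt d (stripCol w n σ a d) ∈ strip w n τ a := by
      rw [← key, boxAt_mem_strip]; exact ⟨ha, rfl⟩
    have h2 := (boxAt_mem_strip.1 h1).2
    simp only [stripCol] at h2
    omega
  rw [← rank_lt_rank_iff (f := σ) ha, ← rank_lt_rank_iff (f := τ) ha, hrank a ha, hrank b hb]

/-! ### Injectivity on canonical orders -/

lemma exists_active_of_lt_add {n k : ℕ} {a b : Fin (n + k)} (hab : (a : ℕ) < b + n)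
    (hba : (b : ℕ) < a + n) : ∃ d, Active n k d a ∧ Active n k d b := by
  refine ⟨max (startContent a) (startContent b), ?_, ?_⟩ <;>
  · rw [active_iff]; simp only [startContent]; omega

/-- Two canonical orders that agree on strips with a common diagonal agree on `newStrip t` and
`oldStrip s`: the strip just before `oldStrip s` is compared with both, by induction on the
distance. -/
lemma IsCanonical.lt_of_lt {n k : ℕ} (hk : k ≤ n) {u : Fin k → Letter}
    {σ τ : Equiv.Perm (Fin (n + k))} (hσ : RespectsLetters u σ) (hτ : RespectsLetters u τ)
    (hcan : IsCanonical σ)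
    (h : ∀ a b : Fin (n + k), (a : ℕ) < b + n → (b : ℕ) < a + n → (σ a < σ b ↔ τ a < τ b))
    (D : ℕ) : ∀ s t : Fin k, s ≤ t → σ (newStrip n t) < σ (oldStrip n s) →
      (σ (oldStrip n s) : ℕ) ≤ σ (newStrip n t) + D →
      τ (newStrip n t) < τ (oldStrip n s) := by
  induction D with
  | zero => intro s t _ h1 h2; omega
  | succ D ih =>
    intro s t hst h1 h2
    have hletter : ∀ t, σ (newStrip n t) < σ (oldStrip n t) →
        τ (newStrip n t) < τ (oldStrip n t) := by
      intro t ht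
      cases hu : u t
      · exact (hτ t).2 hu
      · exact absurd ((hσ t).1 hu) (by omega)
    rcases hst.eq_or_lt with rfl | hst
    · exact hletter s h1
    obtain ⟨z, hz⟩ : ∃ z, (σ z : ℕ) + 1 = σ (oldStrip n s) :=
      ⟨σ.symm ⟨σ (oldStrip n s) - 1, by omega⟩, by
        rw [Equiv.apply_symm_apply]; dsimp only; omega⟩
    have hzt : σ (newStrip n t) < σ z := by
      have := hcan s t hst
      omega
    have hlt : τ z < τ (oldStrip n s) := by
      rcases lt_or_ge (z : ℕ) (n + s) with hzs | hzs
      · rw [← h z (oldStrip n s) (by simp only [val_oldStrip]; omega)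
          (by simp only [val_oldStrip]; omega)]
        omega
      · obtain ⟨t', rfl⟩ : ∃ t', z = newStrip n t' :=
          ⟨⟨z - n, by omega⟩, Fin.ext (by rw [val_newStrip]; dsimp only; omega)⟩
        rw [val_newStrip] at hzs
        rcases (show s ≤ t' by omega).eq_or_lt with rfl | hst'
        · exact hletter _ (by omega)
        · exact absurd hz.symm (hcan s t' hst')
    refine lt_trans ?_ hlt
    rcases lt_or_ge (t : ℕ) z with hzs | hzs
    · rw [← h (newStrip n t) z (by simp only [val_newStrip]; omega)
          (by simp only [val_newStrip]; omega)]
      exact hzt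
    · obtain ⟨s', rfl⟩ : ∃ s' : Fin k, z = oldStrip n s' :=
        ⟨⟨z, by omega⟩, Fin.ext rfl⟩
      rw [val_oldStrip] at hzs
      exact ih s' t (by omega) hzt (by omega)

/-- An enumeration is determined by the order that it induces. -/
lemma equiv_fin_eq_of_lt_iff_lt {α : Type*} {m : ℕ} {σ τ : α ≃ Fin m}
    (h : ∀ a b, σ a < σ b ↔ τ a < τ b) : σ = τ := by
  let e : Fin m ≃o Fin m :=
    { toEquiv := σ.symm.trans τ
      map_rel_iff' := by
        intro a b
        have := h (σ.symm b) (σ.symm a)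
        rw [Equiv.apply_symm_apply, Equiv.apply_symm_apply] at this
        rw [Equiv.trans_apply, Equiv.trans_apply, ← not_lt, ← this, not_lt] }
  have he : e = OrderIso.refl _ := Subsingleton.elim _ _
  ext a : 1
  have := congrArg (fun f : Fin m ≃o Fin m => f (σ a)) he
  simpa [e] using this.symm

lemma IsCanonical.eq_of_lt_iff_lt {n k : ℕ} (hk : k ≤ n) {u : Fin k → Letter}
    {σ τ : Equiv.Perm (Fin (n + k))} (hσ : RespectsLetters u σ) (hτ : RespectsLetters u τ)
    (hσc : IsCanonical σ) (hτc : IsCanonical τ)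
    (h : ∀ a b : Fin (n + k), (a : ℕ) < b + n → (b : ℕ) < a + n → (σ a < σ b ↔ τ a < τ b)) :
    σ = τ := by
  have hfar : ∀ a b : Fin (n + k), (a : ℕ) + n ≤ b → (σ b < σ a ↔ τ b < τ a) := by
    intro a b hab
    obtain ⟨s, rfl⟩ : ∃ s : Fin k, a = oldStrip n s := ⟨⟨a, by omega⟩, Fin.ext rfl⟩
    obtain ⟨t, rfl⟩ : ∃ t, b = newStrip n t :=
      ⟨⟨b - n, by omega⟩, Fin.ext (by rw [val_newStrip]; dsimp only; omega)⟩
    simp only [val_oldStrip, val_newStrip] at hab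
    have hst : s ≤ t := by omega
    exact ⟨fun h1 => hσc.lt_of_lt hk hσ hτ h (n + k) s t hst h1 (by omega),
      fun h1 => hτc.lt_of_lt hk hτ hσ (fun a b h2 h3 => (h a b h2 h3).symm) (n + k) s t hst h1
        (by omega)⟩
  refine equiv_fin_eq_of_lt_iff_lt fun a b => ?_
  by_cases h1 : (a : ℕ) < b + n
  · by_cases h2 : (b : ℕ) < a + n
    · exact h a b h1 h2
    · have h3 := hfar a b (by omega)
      have hne : a ≠ b := by rintro rfl; have := a.2; omega
      have h4 := σ.injective.ne hne
      have h5 := τ.injective.ne hne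
      omega
  · exact hfar b a (by omega)

/-! ### Amalgamation of local orders -/

/-- The local orders of a decomposition can be amalgamated into one order, realized by rational
numbers. The strips are inserted one by one, each as far to the right as its local constraints
allow, which makes the order canonical. -/
lemma exists_amalgamation {n k : ℕ} (hk : k ≤ n) (u : Fin k → Letter) (R : ℕ → ℕ → Prop)
    (hR : ∀ c < n + k, ∃ f : ℕ → ℤ, Set.InjOn f {a | a ≤ c ∧ c < a + n} ∧
      ∀ a b, a ≤ c → c < a + n → b ≤ c → c < b + n → (R a b ↔ f a < f b))
    (hc : ∀ t : Fin k, u t = Letter.c → ∀ a, (t : ℕ) < a → a < n + t → R (n + t) a → R t a)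
    (hr : ∀ t : Fin k, u t = Letter.r → ∀ a, (t : ℕ) < a → a < n + t → R t a → R (n + t) a)
    (m : ℕ) (hm : m ≤ n + k) :
    ∃ h : ℕ → ℚ, Set.InjOn h (Set.Iio m) ∧
      (∀ a b, a < m → b < m → a < b + n → b < a + n → (h a < h b ↔ R a b)) ∧
      (∀ t : Fin k, n + (t : ℕ) < m → (u t = Letter.c → h t < h (n + t)) ∧
        (u t = Letter.r → h (n + t) < h t)) ∧
      (∀ s t : Fin k, s < t → n + (t : ℕ) < m → h (n + t) < h s →
        ∃ z < m, h (n + t) < h z ∧ h z < h s) := by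
  classical
  induction m with
  | zero => exact ⟨fun _ => 0, by simp [Set.InjOn], by simp, by simp, by simp⟩
  | succ m ih =>
    obtain ⟨h, hinj, hloc, hlet, hcan⟩ := ih (by omega)
    obtain ⟨f, hf, hRf⟩ := hR m (by omega)
    let up : ℕ → Prop := fun a => a < m ∧ ((m < a + n ∧ R m a) ∨
      ∃ t : Fin k, n + (t : ℕ) = m ∧ a = t ∧ u t = Letter.r)
    let low : ℕ → Prop := fun a => a < m ∧ ((m < a + n ∧ R a m) ∨
      ∃ t : Fin k, n + (t : ℕ) = m ∧ a = t ∧ u t = Letter.c)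
    have hlu : ∀ a b, low a → up b → h a < h b := by
      rintro a b ⟨ham, ha⟩ ⟨hbm, hb⟩
      rcases ha with ⟨ha, ha'⟩ | ⟨t, ht, rfl, hu⟩
      · rcases hb with ⟨hb, hb'⟩ | ⟨t, ht, rfl, hu⟩
        · rw [hloc a b ham hbm (by omega) (by omega), hRf a b ham.le ha hbm.le hb]
          rw [hRf a m ham.le ha le_rfl (by omega)] at ha'
          rw [hRf m b le_rfl (by omega) hbm.le hb] at hb'
          exact ha'.trans hb'
        · by_contra hcon
          have hne : h a ≠ h t := fun he => by
            have := hinj ham hbm he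
            omega
          have h1 : h t < h a := lt_of_le_of_ne (not_lt.1 hcon) hne.symm
          rw [hloc t a hbm ham (by omega) (by omega)] at h1
          have h2 := hr t hu a (by omega) (by omega) h1
          rw [ht, hRf m a le_rfl (by omega) ham.le ha] at h2
          rw [hRf a m ham.le ha le_rfl (by omega)] at ha'
          exact lt_asymm ha' h2
      · rcases hb with ⟨hb, hb'⟩ | ⟨t', ht', rfl, hu'⟩
        · rw [hloc t b ham hbm (by omega) (by omega)]
          exact hc t hu b (by omega) (by omega) (by rwa [ht])
        · have : t = t' := by omega
          rw [this, hu'] at hu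
          simp at hu
    -- the new value lies above everything that lies below all the upper constraints
    obtain ⟨v, hv1, hv2⟩ := Order.exists_between_finsets
      ((Finset.range m).filter (fun b => ∀ a, up a → h b < h a) |>.image h)
      ((Finset.range m).filter (fun b => ∃ a, up a ∧ h a ≤ h b) |>.image h) (by
        simp only [Finset.mem_image, Finset.mem_filter]
        rintro x ⟨a, ⟨-, ha⟩, rfl⟩ y ⟨b, ⟨-, c, hc1, hc2⟩, rfl⟩
        exact (ha c hc1).trans_le hc2)
    have hvlo : ∀ b < m, (∀ a, up a → h b < h a) → h b < v := fun b hb hb' =>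
      hv1 _ (Finset.mem_image_of_mem _ (Finset.mem_filter.2 ⟨Finset.mem_range.2 hb, hb'⟩))
    have hvhi : ∀ b < m, (∃ a, up a ∧ h a ≤ h b) → v < h b := fun b hb hb' =>
      hv2 _ (Finset.mem_image_of_mem _ (Finset.mem_filter.2 ⟨Finset.mem_range.2 hb, hb'⟩))
    have hvne : ∀ b < m, h b ≠ v := by
      intro b hb he
      by_cases hb' : ∀ a, up a → h b < h a
      · exact absurd (hvlo b hb hb') (by rw [he]; exact lt_irrefl _)
      · push Not at hb'
        exact absurd (hvhi b hb hb') (by rw [he]; exact lt_irrefl _)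
    have hlow : ∀ b, low b → h b < v := fun b hb => hvlo b hb.1 fun a ha => hlu b a hb ha
    have hup : ∀ b, up b → v < h b := fun b hb => hvhi b hb.1 ⟨b, hb, le_rfl⟩
    have hnear : ∀ a < m, m < a + n → (h a < v ↔ R a m) ∧ (v < h a ↔ R m a) := by
      intro a ha ha'
      have h1 : R a m → h a < v := fun hh => hlow a ⟨ha, Or.inl ⟨ha', hh⟩⟩
      have h2 : R m a → v < h a := fun hh => hup a ⟨ha, Or.inl ⟨ha', hh⟩⟩
      have h3 : R a m ∨ R m a := by
        rw [hRf a m ha.le ha' le_rfl (by omega), hRf m a le_rfl (by omega) ha.le ha']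
        refine lt_or_gt_of_ne fun he => ?_
        have := hf (show a ∈ {a | a ≤ m ∧ m < a + n} from ⟨ha.le, ha'⟩)
          (show m ∈ {a | a ≤ m ∧ m < a + n} from ⟨le_rfl, by omega⟩) he
        omega
      refine ⟨⟨fun hh => h3.resolve_right fun h4 => lt_asymm hh (h2 h4), h1⟩,
        ⟨fun hh => h3.resolve_left fun h4 => lt_asymm hh (h1 h4), h2⟩⟩
    have hR0 : ∀ a < n + k, 0 < n → ¬ R a a := by
      intro a ha hn
      obtain ⟨f, -, hRf⟩ := hR a ha
      rw [hRf a a le_rfl (by omega) le_rfl (by omega)]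
      exact lt_irrefl _
    have hold : ∀ a, a < m → Function.update h m v a = h a := fun a ha =>
      Function.update_of_ne ha.ne _ _
    have hnew : Function.update h m v m = v := Function.update_self _ _ _
    refine ⟨Function.update h m v, ?_, ?_, ?_, ?_⟩
    · intro a ha b hb he
      simp only [Set.mem_Iio] at ha hb
      rcases (Nat.lt_succ_iff.1 ha).eq_or_lt with rfl | ha'
      · rcases (Nat.lt_succ_iff.1 hb).eq_or_lt with rfl | hb'
        · rfl
        · rw [hnew, hold b hb'] at he
          exact absurd he.symm (hvne b hb')
      · rcases (Nat.lt_succ_iff.1 hb).eq_or_lt with rfl | hb'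
        · rw [hnew, hold a ha'] at he
          exact absurd he (hvne a ha')
        · rw [hold a ha', hold b hb'] at he
          exact hinj ha' hb' he
    · intro a b ha hb hab hba
      rcases (Nat.lt_succ_iff.1 ha).eq_or_lt with rfl | ha'
      · rcases (Nat.lt_succ_iff.1 hb).eq_or_lt with rfl | hb'
        · simpa using hR0 b (by omega) (by omega)
        · rw [hnew, hold b hb']
          exact (hnear b hb' hab).2
      · rcases (Nat.lt_succ_iff.1 hb).eq_or_lt with rfl | hb'
        · rw [hnew, hold a ha']
          exact (hnear a ha' hba).1
        · rw [hold a ha', hold b hb']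
          exact hloc a b ha' hb' hab hba
    · intro t ht
      have htk := t.2
      rcases (Nat.lt_succ_iff.1 ht).eq_or_lt with ht' | ht'
      · rw [ht', hnew, hold t (by omega)]
        exact ⟨fun hu => hlow t ⟨by omega, Or.inr ⟨t, ht', rfl, hu⟩⟩,
          fun hu => hup t ⟨by omega, Or.inr ⟨t, ht', rfl, hu⟩⟩⟩
      · rw [hold _ ht', hold t (by omega)]
        exact hlet t ht'
    · intro s t hst ht hlt
      have htk := t.2
      rcases (Nat.lt_succ_iff.1 ht).eq_or_lt with ht' | ht'
      · rw [ht', hnew, hold s (by omega)] at hlt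
        have hs : ∃ a, up a ∧ h a ≤ h s := by
          by_contra hcon
          push Not at hcon
          exact lt_asymm hlt (hvlo s (by omega) hcon)
        obtain ⟨a, ha, has⟩ := hs
        have hne : a ≠ s := by
          rcases ha.2 with ⟨h1, -⟩ | ⟨t', h1, h2, -⟩ <;> omega
        refine ⟨a, by have := ha.1; omega, ?_, ?_⟩
        · rw [ht', hnew, hold a ha.1]; exact hup a ha
        · rw [hold a ha.1, hold s (by omega)]
          exact lt_of_le_of_ne has fun he => hne (hinj ha.1 (show (s : ℕ) < m by omega) he)
      · rw [hold _ ht', hold s (by omega)] at hlt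
        obtain ⟨z, hz, h1, h2⟩ := hcan s t hst ht' hlt
        exact ⟨z, by omega, by rw [hold _ ht', hold z hz]; exact h1,
          by rw [hold z hz, hold s (by omega)]; exact h2⟩

lemma exists_equiv_fin_lt_iff_lt {α β : Type*} [LinearOrder β] {m : ℕ} (e : α ≃ Fin m) {h : α → β}
    (hinj : Function.Injective h) : ∃ σ : α ≃ Fin m, ∀ a b, σ a < σ b ↔ h a < h b := by
  refine ⟨e.trans (Tuple.sort (h ∘ e.symm)).symm, fun a b => ?_⟩
  have hs : StrictMono ((h ∘ e.symm) ∘ Tuple.sort (h ∘ e.symm)) :=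
    (Tuple.monotone_sort _).strictMono_of_injective
      ((hinj.comp e.symm.injective).comp (Tuple.sort _).injective)
  rw [← hs.lt_iff_lt]
  simp

/-! ### From decompositions to orders of the strips -/

/-- Passing from a point to the next one in a family of intervals of length `n`. -/
lemma card_filter_Ico_succ {γ : Type*} (C : Finset γ) (r : γ → ℤ) {n : ℕ} (hn : 0 < n) (d : ℤ) :
    (C.filter fun a => r a ≤ d + 1 ∧ d + 1 < r a + n).card +
        (C.filter fun a => r a = d + 1 - n).card =
      (C.filter fun a => r a ≤ d ∧ d < r a + n).card + (C.filter fun a => r a = d + 1).card := by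
  classical
  rw [← Finset.card_union_of_disjoint, ← Finset.card_union_of_disjoint]
  · congr 1
    ext a
    simp only [Finset.mem_union, Finset.mem_filter, ← and_or_left]
    refine and_congr_right fun _ => ?_
    omega
  all_goals
    refine Finset.disjoint_left.2 fun a ha hb => ?_
    have h1 := (Finset.mem_filter.1 ha).2
    have h2 := (Finset.mem_filter.1 hb).2
    omega

/-- Two finite families of intervals of length `n` that cover every point equally often have equally
many members starting at each point. -/
lemma card_filter_start_eq {ι κ : Type*} (A : Finset ι) (B : Finset κ) (s : ι → ℤ) (s' : κ → ℤ)
    {n : ℕ} (hn : 0 < n)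
    (h : ∀ d, (A.filter fun a => s a ≤ d ∧ d < s a + n).card =
      (B.filter fun b => s' b ≤ d ∧ d < s' b + n).card) (e : ℤ) :
    (A.filter fun a => s a = e).card = (B.filter fun b => s' b = e).card := by
  classical
  obtain ⟨m, hm⟩ : ∃ m : ℤ, (∀ a ∈ A, m ≤ s a) ∧ ∀ b ∈ B, m ≤ s' b := by
    obtain ⟨m, hm⟩ := (A.image s ∪ B.image s').bddBelow
    exact ⟨m, fun a ha => hm (by simpa using Or.inl ⟨a, ha, rfl⟩),
      fun b hb => hm (by simpa using Or.inr ⟨b, hb, rfl⟩)⟩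
  have key : ∀ i : ℕ, ∀ e : ℤ, e < m + i →
      (A.filter fun a => s a = e).card = (B.filter fun b => s' b = e).card := by
    intro i
    induction i with
    | zero =>
      intro e he
      rw [Finset.filter_false_of_mem (s := A), Finset.filter_false_of_mem (s := B)]
      · simp
      · intro b hb h'
        have := hm.2 b hb
        omega
      · intro a ha h'
        have := hm.1 a ha
        omega
    | succ i ih =>
      intro e he
      have h1 := card_filter_Ico_succ A s hn (e - 1)
      have h2 := card_filter_Ico_succ B s' hn (e - 1)
      have h3 := ih (e - 1 + 1 - n) (by omega)
      have h4 := h (e - 1)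
      have h5 := h (e - 1 + 1)
      rw [sub_add_cancel] at *
      omega
  exact key (e - m + 1).toNat e (by omega)

/-- The strips of a border-strip decomposition can be labelled in such a way that strip `a` starts
at content `startContent a`; `g a` gives the columns of its boxes. -/
lemma exists_labelling {w : List Letter} {n : ℕ} (hn : 0 < n) {P : Finpartition (simpleDiagram w n)}
    (hP : P ∈ BSD w n) :
    ∃ g : Fin (n + w.length) → ℤ → ℤ, (∀ a, IsStepping (g a) (startContent a) n) ∧
      (∀ a, pathBoxes (g a) (startContent a) n ∈ P.parts) ∧
      ∀ S ∈ P.parts, ∃ a, S = pathBoxes (g a) (startContent a) n := by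
  classical
  have hex : ∀ S ∈ P.parts, ∃ (g : ℤ → ℤ) (e : ℤ), IsStepping g e n ∧ S = pathBoxes g e n :=
    fun S hS => (hP S hS).1.exists_pathBoxes (hP S hS).2
  choose! g e hg hS using hex
  have hcount : ∀ d, (P.parts.filter fun S => e S ≤ d ∧ d < e S + n).card =
      (Finset.univ.filter fun a : Fin (n + w.length) =>
        startContent a ≤ d ∧ d < startContent a + n).card := by
    intro d
    have : (Finset.univ.filter fun a : Fin (n + w.length) =>
        startContent a ≤ d ∧ d < startContent a + n).card =
        (Finset.Ico (leftCol w d)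
          (leftCol w d + (Finset.univ.filter (Active n w.length d)).card)).card := by
      rw [Int.card_Ico, add_sub_cancel_left, Int.toNat_natCast]
      congr 1
      ext a
      simp only [Finset.mem_filter, Finset.mem_univ, true_and, active_iff]
    rw [this]
    refine Finset.card_bij (fun S _ => g S d) ?_ ?_ ?_
    · intro S hSm
      obtain ⟨hSP, hd⟩ := Finset.mem_filter.1 hSm
      have hmem : boxAt d (g S d) ∈ S := by
        have : boxAt d (g S d) ∈ pathBoxes (g S) (e S) n := boxAt_mem_pathBoxes.2 ⟨hd, rfl⟩
        rwa [← hS S hSP] at this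
      rw [Finset.mem_Ico, ← boxAt_mem_simpleDiagram_iff_card_active rfl]
      exact P.le hSP hmem
    · intro S hSm T hTm heq
      obtain ⟨hSP, hd⟩ := Finset.mem_filter.1 hSm
      obtain ⟨hTP, hd'⟩ := Finset.mem_filter.1 hTm
      have h1 : boxAt d (g S d) ∈ pathBoxes (g S) (e S) n := boxAt_mem_pathBoxes.2 ⟨hd, rfl⟩
      have h2 : boxAt d (g T d) ∈ pathBoxes (g T) (e T) n := boxAt_mem_pathBoxes.2 ⟨hd', rfl⟩
      rw [← hS S hSP] at h1
      rw [← hS T hTP, ← heq] at h2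
      exact P.eq_of_mem_parts hSP hTP h1 h2
    · intro j hj
      rw [Finset.mem_Ico, ← boxAt_mem_simpleDiagram_iff_card_active rfl] at hj
      obtain ⟨S, hSP, hmem⟩ := P.exists_mem hj
      have hmem' := hmem
      rw [hS S hSP, boxAt_mem_pathBoxes] at hmem'
      exact ⟨S, Finset.mem_filter.2 ⟨hSP, hmem'.1⟩, hmem'.2⟩
  have hstart := card_filter_start_eq P.parts Finset.univ e
    (startContent : Fin (n + w.length) → ℤ) hn hcount
  have hlabel : ∀ a : Fin (n + w.length), ∃ S ∈ P.parts, e S = startContent a := by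
    intro a
    have h1 : 0 < (P.parts.filter fun S => e S = startContent a).card := by
      rw [hstart]
      exact Finset.card_pos.2 ⟨a, by simp⟩
    obtain ⟨S, hS⟩ := Finset.card_pos.1 h1
    exact ⟨S, (Finset.mem_filter.1 hS).1, (Finset.mem_filter.1 hS).2⟩
  choose T hT hTe using hlabel
  refine ⟨fun a => g (T a), fun a => hTe a ▸ hg _ (hT a), fun a => ?_, fun S hSP => ?_⟩
  · have := hT a
    rwa [hS _ (hT a), hTe a] at this
  · have h1 : 0 < (P.parts.filter fun S' => e S' = e S).card :=
      Finset.card_pos.2 ⟨S, by simp [hSP]⟩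
    rw [hstart] at h1
    obtain ⟨a, ha⟩ := Finset.card_pos.1 h1
    have ha' : startContent a = e S := (Finset.mem_filter.1 ha).2
    -- only one part starts at this content
    have h2 : (P.parts.filter fun S' => e S' = e S).card ≤ 1 := by
      rw [hstart]
      refine Finset.card_le_one.2 fun b hb c hc => ?_
      have hb := (Finset.mem_filter.1 hb).2
      have hc := (Finset.mem_filter.1 hc).2
      simp only [startContent] at hb hc
      exact Fin.ext (by omega)
    have h3 : T a = S := Finset.card_le_one.1 h2 _ (by simp [hT, hTe, ha']) _ (by simp [hSP])
    refine ⟨a, ?_⟩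
    dsimp only
    rw [h3, ha']
    exact hS S hSP

/-- Every decomposition comes from a canonical order of its strips. -/
lemma exists_decomposition_eq {w : List Letter} {n : ℕ} (hn : 0 < n) (hk : w.length ≤ n)
    {P : Finpartition (simpleDiagram w n)} (hP : P ∈ BSD w n) :
    ∃ σ : Equiv.Perm (Fin (n + w.length)), RespectsLetters w.get σ ∧ IsCanonical σ ∧
      decomposition w hn σ = P := by
  classical
  obtain ⟨g, hg, hgP, hPg⟩ := exists_labelling hn hP
  have hmem : ∀ {a : Fin (n + w.length)} {d}, Active n w.length d a →
      boxAt d (g a d) ∈ pathBoxes (g a) (startContent a) n := fun h =>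
    boxAt_mem_pathBoxes.2 ⟨active_iff.1 h, rfl⟩
  have hrange : ∀ d (a : Fin (n + w.length)), Active n w.length d a → leftCol w d ≤ g a d ∧
      g a d < leftCol w d + (Finset.univ.filter (Active n w.length d)).card := fun d a ha =>
    (boxAt_mem_simpleDiagram_iff_card_active rfl _ _).1 (P.le (hgP a) (hmem ha))
  have hinj : ∀ d, Set.InjOn (fun a => g a d) {a | Active n w.length d a} := by
    intro d a ha b hb hab
    dsimp only at hab
    have h1 := hmem ha
    have h2 := hmem hb
    rw [← hab] at h2
    have h3 := P.eq_of_mem_parts (hgP a) (hgP b) h1 h2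
    have h4 := hmem (a := a) (d := startContent a) (active_iff.2 (by omega))
    have h5 := hmem (a := b) (d := startContent b) (active_iff.2 (by omega))
    rw [h3, boxAt_mem_pathBoxes] at h4
    rw [← h3, boxAt_mem_pathBoxes] at h5
    simp only [startContent] at h4 h5
    exact Fin.ext (by omega)
  -- strips do not cross, so that their order is the same on all common diagonals
  have hsucc : ∀ d (a b : Fin (n + w.length)), Active n w.length d a → Active n w.length d b →
      Active n w.length (d + 1) a → Active n w.length (d + 1) b →
      (g a d < g b d ↔ g a (d + 1) < g b (d + 1)) := by
    intro d a b ha hb ha' hb'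
    rcases eq_or_ne a b with rfl | hab
    · simp
    have h1 := hg a d (active_iff.1 ha).1 (active_iff.1 ha').2
    have h2 := hg b d (active_iff.1 hb).1 (active_iff.1 hb').2
    have h3 : g a d ≠ g b d := fun he => hab (hinj d ha hb he)
    have h4 : g a (d + 1) ≠ g b (d + 1) := fun he => hab (hinj (d + 1) ha' hb' he)
    omega
  have hconst : ∀ d e (a b : Fin (n + w.length)), d ≤ e → Active n w.length d a →
      Active n w.length d b → Active n w.length e a → Active n w.length e b →
      (g a d < g b d ↔ g a e < g b e) := by
    intro d e a b hde ha hb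
    induction e, hde using Int.leInduction with
    | base => intro _ _; rfl
    | succ e hde ih =>
      intro ha' hb'
      have ha'' : Active n w.length e a := by simp only [Active] at ha ha' ⊢; omega
      have hb'' : Active n w.length e b := by simp only [Active] at hb hb' ⊢; omega
      rw [ih ha'' hb'', hsucc e a b ha'' hb'' ha' hb']
  -- the order of two strips with a common diagonal, read off on the first such diagonal
  let R' : Fin (n + w.length) → Fin (n + w.length) → Prop := fun a b =>
    g a (max (startContent a) (startContent b)) < g b (max (startContent a) (startContent b))
  have hR' : ∀ d (a b : Fin (n + w.length)), Active n w.length d a → Active n w.length d b →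
      (R' a b ↔ g a d < g b d) := by
    intro d a b ha hb
    have ha1 := active_iff.1 ha
    have hb1 := active_iff.1 hb
    refine hconst _ _ _ _ (by omega) (active_iff.2 ?_) (active_iff.2 ?_) ha hb <;> omega
  let R : ℕ → ℕ → Prop := fun a b => ∃ (ha : a < n + w.length)
    (hb : b < n + w.length), R' ⟨a, ha⟩ ⟨b, hb⟩
  have hRR : ∀ a b : Fin (n + w.length), R a b ↔ R' a b := fun a b =>
    ⟨fun ⟨_, _, h⟩ => h, fun h => ⟨a.2, b.2, h⟩⟩
  have hact : ∀ {c a : ℕ} (hc : c < n + w.length) (h1 : a ≤ c) (_ : c < a + n),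
      Active n w.length ((c : ℤ) - n - w.length + 1) ⟨a, by omega⟩ := fun hc h1 h2 => by
    simp only [Active]; omega
  have hrank : ∀ d (a : Fin (n + w.length)), Active n w.length d a →
      g a d = leftCol w d + (Finset.univ.filter fun b => Active n w.length d b ∧ R' b a).card := by
    intro d a ha
    have := eq_add_rank (hinj d) (hrange d) ha
    rw [rank] at this
    rw [this]
    congr 3
    ext b
    simp only [Finset.mem_filter, Finset.mem_univ, true_and]
    exact and_congr_right fun hb => (hR' d b a hb ha).symm
  -- a strip moves by at most one column, which bounds the change of its rank at each letter
  have hletter : ∀ (t : Fin w.length) (a : Fin (n + w.length)), (t : ℕ) < a → (a : ℕ) < n + t →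
      (w.get t = Letter.c → R' (newStrip n t) a → R' (oldStrip n t) a) ∧
      (w.get t = Letter.r → R' (oldStrip n t) a → R' (newStrip n t) a) := by
    intro t a h1 h2
    obtain ⟨d, hd⟩ : ∃ d : ℤ, d = t - w.length := ⟨_, rfl⟩
    have ha : Active n w.length d a := by simp only [Active]; omega
    have ha' : Active n w.length (d + 1) a := by simp only [Active]; omega
    have h3 := card_active_succ hn d fun b => R' b a
    have h4 := hrank d a ha
    have h5 := hrank (d + 1) a ha'
    have h6 := hg a d (active_iff.1 ha).1 (active_iff.1 ha').2
    rw [card_filter_eq_and (d + w.length) (oldStrip n t) (by rw [val_oldStrip]; omega),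
      card_filter_eq_and (d + n + w.length) (newStrip n t)
        (by rw [val_newStrip]; push_cast; omega)] at h3
    rw [leftCol_succ_of_letter (t := t) t.2 hd] at h5
    rw [List.get_eq_getElem]
    constructor
    · intro hu h7
      by_contra h8
      rw [if_pos hu] at h5
      rw [if_pos h7, if_neg h8] at h3
      omega
    · intro hu h7
      by_contra h8
      rw [if_neg (by rw [hu]; simp)] at h5
      rw [if_pos h7, if_neg h8] at h3
      omega
  obtain ⟨h, hh1, hh2, hh3, hh4⟩ := exists_amalgamation hk w.get R
    (fun c hc => by
      refine ⟨fun a => if ha : a < n + w.length then g ⟨a, ha⟩ (c - n - w.length + 1) else 0,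
        ?_, ?_⟩
      · rintro a ⟨ha1, ha2⟩ b ⟨hb1, hb2⟩ he
        simp only [dif_pos (show a < n + w.length by omega),
          dif_pos (show b < n + w.length by omega)] at he
        exact congrArg Fin.val (hinj _ (hact hc ha1 ha2) (hact hc hb1 hb2) he)
      · intro a b ha1 ha2 hb1 hb2
        dsimp only
        rw [dif_pos (show a < n + w.length by omega), dif_pos (show b < n + w.length by omega),
          ← hR' _ _ _ (hact hc ha1 ha2) (hact hc hb1 hb2)]
        exact hRR ⟨a, by omega⟩ ⟨b, by omega⟩)
    (fun t hu a ha1 ha2 hRa => by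
      have h1 := (hRR (newStrip n t) ⟨a, by omega⟩).1 hRa
      exact (hRR (oldStrip n t) ⟨a, by omega⟩).2 ((hletter t ⟨a, by omega⟩ ha1 ha2).1 hu h1))
    (fun t hu a ha1 ha2 hRa => by
      have h1 := (hRR (oldStrip n t) ⟨a, by omega⟩).1 hRa
      exact (hRR (newStrip n t) ⟨a, by omega⟩).2 ((hletter t ⟨a, by omega⟩ ha1 ha2).2 hu h1))
    (n + w.length) le_rfl
  obtain ⟨σ, hσ⟩ := exists_equiv_fin_lt_iff_lt (Equiv.refl _)
    (h := fun a : Fin (n + w.length) => h a)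
    (fun a b hab => Fin.ext (hh1 a.2 b.2 hab))
  have hstrip : ∀ a, strip w n σ a = pathBoxes (g a) (startContent a) n := by
    intro a
    refine Finset.image_congr fun d hd => ?_
    have ha : Active n w.length d a := active_iff.2 (by simpa using hd)
    rw [hrank d a ha, stripCol, rank]
    congr 4
    ext b
    simp only [Finset.mem_filter, Finset.mem_univ, true_and]
    refine and_congr_right fun hb => ?_
    have ha1 := ha
    have hb1 := hb
    simp only [Active] at ha1 hb1
    rw [hσ, hh2 b a b.2 a.2 (by omega) (by omega), hRR]
  refine ⟨σ, fun t => ?_, fun s t hst he => ?_, ?_⟩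
  · rw [LetterOrder, hσ, hσ]
    exact hh3 t (by omega)
  · have h1 : σ (newStrip n t) < σ (oldStrip n s) := by omega
    rw [hσ] at h1
    obtain ⟨z, hz, h2, h3⟩ := hh4 s t hst (by omega) h1
    have h4 := (hσ (newStrip n t) ⟨z, hz⟩).2 h2
    have h5 := (hσ ⟨z, hz⟩ (oldStrip n s)).2 h3
    omega
  · refine Finpartition.ext ?_
    ext S
    rw [mem_parts_decomposition]
    constructor
    · rintro ⟨a, rfl⟩
      rw [hstrip]; exact hgP a
    · intro hS
      obtain ⟨a, rfl⟩ := hPg S hS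
      exact ⟨a, hstrip a⟩

/-- Border-strip decompositions correspond to canonical orders of `n + k` strips. -/
theorem ncard_BSD {w : List Letter} {n : ℕ} (hn : 0 < n) (hk : w.length ≤ n) :
    (BSD w n).ncard =
      {σ : Equiv.Perm (Fin (n + w.length)) | RespectsLetters w.get σ ∧ IsCanonical σ}.ncard := by
  have himg : BSD w n = decomposition w hn ''
      {σ : Equiv.Perm (Fin (n + w.length)) | RespectsLetters w.get σ ∧ IsCanonical σ} := by
    ext P
    constructor
    · intro hP
      obtain ⟨σ, h1, h2, h3⟩ := exists_decomposition_eq hn hk hP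
      exact ⟨σ, ⟨h1, h2⟩, h3⟩
    · rintro ⟨σ, ⟨h1, h2⟩, rfl⟩
      exact decomposition_mem_BSD hn h1
  rw [himg, Set.InjOn.ncard_image]
  rintro σ ⟨h1, h2⟩ τ ⟨h3, h4⟩ he
  refine h2.eq_of_lt_iff_lt hk h1 h3 h4 fun a b hab hba => ?_
  obtain ⟨d, ha, hb⟩ := exists_active_of_lt_add hab hba
  exact lt_iff_lt_of_decomposition_eq hn he ha hb

/-! ### Counting enumerations with prescribed relations -/

section Count

variable {α : Type*} {m : ℕ}

/-- Relabelling the enumerated elements does not change a count. -/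
lemma ncard_relabel (g : Equiv.Perm α) (Φ : (α ≃ Fin m) → Prop) :
    {f | Φ (g.trans f)}.ncard = {f | Φ f}.ncard := by
  refine Set.ncard_congr (fun f _ => g.trans f) (fun f hf => by simpa using hf)
    (fun f f' _ _ h => ?_) (fun f hf => ⟨g.symm.trans f, ?_, ?_⟩)
  · ext a : 1
    simpa using congrArg (fun e : α ≃ Fin m => e (g.symm a)) h
  · simpa [← Equiv.trans_assoc] using hf
  · simp [← Equiv.trans_assoc]

/-- Among the enumerations with a property that does not distinguish `a` from `b`, half put `a`
before `b`. -/
lemma two_mul_ncard_lt [Fintype α] [DecidableEq α] {a b : α} (hab : a ≠ b) {Φ : (α ≃ Fin m) → Prop}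
    (hΦ : ∀ f, Φ ((Equiv.swap a b).trans f) ↔ Φ f) :
    2 * {f : α ≃ Fin m | Φ f ∧ f a < f b}.ncard =
      {f | Φ f}.ncard := by
  have h1 := ncard_relabel (Equiv.swap a b) fun f : α ≃ Fin m => Φ f ∧ f a < f b
  simp only [hΦ, Equiv.trans_apply, Equiv.swap_apply_left, Equiv.swap_apply_right] at h1
  have h2 : {f | Φ f}.ncard =
      {f : α ≃ Fin m | Φ f ∧ f a < f b}.ncard +
      {f : α ≃ Fin m | Φ f ∧ f b < f a}.ncard := by
    rw [← Set.ncard_union_eq]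
    · congr 1
      ext f
      simp only [Set.mem_union, Set.mem_ofPred_eq, ← and_or_left]
      have := f.injective.ne hab
      exact (and_iff_left (by omega)).symm
    · refine Set.disjoint_left.2 fun f hf hf' => ?_
      exact lt_asymm hf.2 hf'.2
  omega

lemma two_mul_ncard_letterOrder [Fintype α] [DecidableEq α] {a b : α} (hab : a ≠ b)
    {Φ : (α ≃ Fin m) → Prop} (hΦ : ∀ f, Φ ((Equiv.swap a b).trans f) ↔ Φ f) (l : Letter) :
    2 * {f : α ≃ Fin m | Φ f ∧ LetterOrder l (f a) (f b)}.ncard =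
      {f | Φ f}.ncard := by
  cases l
  · rw [← two_mul_ncard_lt hab.symm (Φ := Φ) fun f => by rw [Equiv.swap_comm]; exact hΦ f]
    simp [LetterOrder]
  · rw [← two_mul_ncard_lt hab hΦ]
    simp [LetterOrder]

/-- Prescribing the orders of disjoint pairs divides the number of enumerations by a
power of `2`. -/
lemma two_pow_mul_ncard_letterOrder [Fintype α] [DecidableEq α] {ι : Type*} (U : Finset ι)
    {x y : ι → α} (u : ι → Letter)
    (hxy : ∀ i ∈ U, ∀ j ∈ U, x i ≠ y j) (hx : Set.InjOn x U) (hy : Set.InjOn y U)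
    {Φ : (α ≃ Fin m) → Prop}
    (hΦ : ∀ i ∈ U, ∀ f, Φ ((Equiv.swap (x i) (y i)).trans f) ↔ Φ f) :
    2 ^ U.card * {f : α ≃ Fin m | Φ f ∧ ∀ i ∈ U, LetterOrder (u i) (f (x i)) (f (y i))}.ncard =
      {f | Φ f}.ncard := by
  classical
  induction U using Finset.induction_on with
  | empty => simp
  | insert i U hi ih =>
    rw [← ih (fun i hi j hj => hxy i (by simp [hi]) j (by simp [hj]))
      (hx.mono (by simp)) (hy.mono (by simp)) fun i hi => hΦ i (by simp [hi]),
      Finset.card_insert_of_notMem hi, pow_succ, mul_assoc]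
    congr 1
    rw [← two_mul_ncard_letterOrder (Φ := fun f => Φ f ∧
      ∀ i ∈ U, LetterOrder (u i) (f (x i)) (f (y i))) (hxy i (by simp) i (by simp)) _ (u i)]
    · congr 2
      ext f
      simp only [Set.mem_ofPred_eq, Finset.mem_insert,
        forall_eq_or_imp]
      tauto
    · intro f
      rw [hΦ i (by simp)]
      refine and_congr_right fun _ => forall₂_congr fun j hj => ?_
      have hne : i ≠ j := fun h => hi (h ▸ hj)
      have h1 : x j ≠ x i := fun h => hne (hx (by simp) (by simp [hj]) h.symm)
      have h2 : x j ≠ y i := hxy j (by simp [hj]) i (by simp)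
      have h3 : y j ≠ x i := (hxy i (by simp) j (by simp [hj])).symm
      have h4 : y j ≠ y i := fun h => hne (hy (by simp) (by simp [hj]) h.symm)
      simp only [Equiv.trans_apply, Equiv.swap_apply_of_ne_of_ne h1 h2,
        Equiv.swap_apply_of_ne_of_ne h3 h4]

lemma ncard_univ_equiv_fin [Fintype α] (hα : Fintype.card α = m) :
    {_f : α ≃ Fin m | True}.ncard = m.factorial := by
  classical
  rw [Set.ofPred_true, Set.ncard_univ, Nat.card_eq_fintype_card,
    Fintype.card_equiv (Fintype.equivFinOfCardEq hα), hα]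

lemma ncard_chain_swap_left {a b c : α} (hac : a ≠ c) (hbc : b ≠ c) :
    {f : α ≃ Fin m | f b < f a ∧ f a < f c}.ncard =
      {f : α ≃ Fin m | f a < f b ∧ f b < f c}.ncard := by
  classical
  have := ncard_relabel (Equiv.swap a b) fun f : α ≃ Fin m => f a < f b ∧ f b < f c
  simp only [Equiv.trans_apply, Equiv.swap_apply_left, Equiv.swap_apply_right,
    Equiv.swap_apply_of_ne_of_ne hac.symm hbc.symm] at this
  exact this

lemma ncard_chain_swap_right {a b c : α} (hab : a ≠ b) (hac : a ≠ c) :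
    {f : α ≃ Fin m | f a < f c ∧ f c < f b}.ncard =
      {f : α ≃ Fin m | f a < f b ∧ f b < f c}.ncard := by
  classical
  have := ncard_relabel (Equiv.swap b c) fun f : α ≃ Fin m => f a < f b ∧ f b < f c
  simp only [Equiv.trans_apply, Equiv.swap_apply_left, Equiv.swap_apply_right,
    Equiv.swap_apply_of_ne_of_ne hab hac] at this
  exact this

lemma six_mul_ncard_chain [Fintype α] (hα : Fintype.card α = m) {a b c : α} (hab : a ≠ b)
    (hac : a ≠ c) (hbc : b ≠ c) :
    6 * {f : α ≃ Fin m | f a < f b ∧ f b < f c}.ncard = m.factorial := by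
  classical
  rw [← ncard_univ_equiv_fin hα]
  have h0 := two_mul_ncard_lt hab (Φ := fun _ : α ≃ Fin m => True) fun f => Iff.rfl
  have h1 := ncard_chain_swap_right (m := m) hab hac
  have h2 := ncard_chain_swap_left (m := m) (a := a) (b := c) (c := b) hab hbc.symm
  have h3 : {f : α ≃ Fin m | True ∧ f a < f b}.ncard =
      {f : α ≃ Fin m | f a < f b ∧ f b < f c}.ncard +
      ({f : α ≃ Fin m | f a < f c ∧ f c < f b}.ncard +
      {f : α ≃ Fin m | f c < f a ∧ f a < f b}.ncard) := by
    rw [← Set.ncard_union_eq, ← Set.ncard_union_eq]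
    · congr 1
      ext f
      have e1 := f.injective.ne hac
      have e2 := f.injective.ne hbc
      simp only [Set.mem_union, Set.mem_ofPred_eq, true_and]
      omega
    all_goals
      refine Set.disjoint_left.2 fun f hf hf' => ?_
      simp only [Set.mem_union, Set.mem_ofPred_eq] at hf hf'
      omega
  omega

/-- Orders of three elements in which the relations of `a` to `b` and of `c` to `a` are prescribed
by letters: one of six if the letters agree, two of six otherwise. -/
lemma six_mul_ncard_letterOrder [Fintype α] (hα : Fintype.card α = m) {a b c : α} (hab : a ≠ b)
    (hac : a ≠ c) (hbc : b ≠ c) (l l' : Letter) :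
    6 * {f : α ≃ Fin m | LetterOrder l (f a) (f b) ∧ LetterOrder l' (f c) (f a)}.ncard =
      (if l = l' then 1 else 2) * m.factorial := by
  cases l <;> cases l' <;>
    simp only [LetterOrder, reduceCtorEq, false_imp_iff, true_imp_iff, true_and, and_true, if_true,
      if_false, one_mul]
  · exact six_mul_ncard_chain hα hab.symm hbc hac
  · have h1 := six_mul_ncard_chain hα hbc hab.symm hac.symm
    have h2 := six_mul_ncard_chain hα hbc.symm hac.symm hab.symm
    have h3 : {f : α ≃ Fin m | f b < f a ∧ f c < f a}.ncard =
        {f : α ≃ Fin m | f b < f c ∧ f c < f a}.ncard +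
        {f : α ≃ Fin m | f c < f b ∧ f b < f a}.ncard := by
      rw [← Set.ncard_union_eq]
      · congr 1
        ext f
        have e2 := f.injective.ne hbc
        simp only [Set.mem_union, Set.mem_ofPred_eq]
        omega
      · refine Set.disjoint_left.2 fun f hf hf' => ?_
        simp only [Set.mem_ofPred_eq] at hf hf'
        omega
    omega
  · have h1 := six_mul_ncard_chain hα hab hac hbc
    have h2 := six_mul_ncard_chain hα hac hab hbc.symm
    have h3 : {f : α ≃ Fin m | f a < f b ∧ f a < f c}.ncard =
        {f : α ≃ Fin m | f a < f b ∧ f b < f c}.ncard +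
        {f : α ≃ Fin m | f a < f c ∧ f c < f b}.ncard := by
      rw [← Set.ncard_union_eq]
      · congr 1
        ext f
        have e2 := f.injective.ne hbc
        simp only [Set.mem_union, Set.mem_ofPred_eq]
        omega
      · refine Set.disjoint_left.2 fun f hf hf' => ?_
        simp only [Set.mem_ofPred_eq] at hf hf'
        omega
    omega
  · rw [← six_mul_ncard_chain hα hac.symm hbc.symm hab]
    simp only [and_comm]

/-- The enumeration of the elements other than `y` that is obtained by deleting `y`. -/
def deleteElt (y : α) (f : α ≃ Fin (m + 1)) : {a // a ≠ y} ≃ Fin m :=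
  (f.subtypeEquiv (q := fun z => z ≠ f y) fun _ => f.apply_eq_iff_eq.not.symm).trans
    (finSuccAboveOrderIso (f y)).symm.toEquiv

lemma deleteElt_lt_iff {y : α} {f : α ≃ Fin (m + 1)} (a b : {a // a ≠ y}) :
    deleteElt y f a < deleteElt y f b ↔ f a < f b :=
  (finSuccAboveOrderIso (f y)).symm.lt_iff_lt

lemma eq_add_one_iff_forall_not_between {β : Type*} (f : β ≃ Fin m) {x y : β} :
    (f x : ℕ) = f y + 1 ↔ f y < f x ∧ ∀ z, ¬ (f y < f z ∧ f z < f x) := by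
  constructor
  · intro h
    exact ⟨by omega, fun z hz => by omega⟩
  · rintro ⟨h1, h2⟩
    by_contra h3
    have := h2 (f.symm ⟨f y + 1, by omega⟩)
    simp only [Equiv.apply_symm_apply, Fin.lt_def] at this
    omega

/-- The enumerations with `y` immediately before `x` correspond to the enumerations of the elements
other than `y`: treat `y` and `x` as a single element. -/
lemma ncard_adjacent [Fintype α] {x y : α} (hxy : x ≠ y) (hα : Fintype.card α = m + 1)
    (Φ : ({a // a ≠ y} ≃ Fin m) → Prop) :
    {f : α ≃ Fin (m + 1) | (f x : ℕ) = f y + 1 ∧ Φ (deleteElt y f)}.ncard = {f | Φ f}.ncard := by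
  classical
  refine Set.ncard_congr (fun f _ => deleteElt y f) (fun f hf => hf.2) ?_ ?_
  · rintro f g ⟨hf1, -⟩ ⟨hg1, -⟩ hfg
    have hlt : ∀ a b, a ≠ y → b ≠ y → (f a < f b ↔ g a < g b) := fun a b ha hb => by
      rw [← deleteElt_lt_iff ⟨a, ha⟩ ⟨b, hb⟩, hfg, deleteElt_lt_iff]
    refine equiv_fin_eq_of_lt_iff_lt fun a b => ?_
    by_cases ha : a = y
    · subst ha
      by_cases hb : b = a
      · subst hb; simp
      · have := hlt b x hb hxy
        have e1 := f.injective.ne hb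
        have e2 := g.injective.ne hb
        omega
    · by_cases hb : b = y
      · subst hb
        have := hlt a x ha hxy
        have e1 := f.injective.ne ha
        have e2 := g.injective.ne ha
        omega
      · exact hlt a b ha hb
  · intro τ hτ
    -- give `y` a value just below the one of `x`
    let h : α → ℤ := fun a => if ha : a = y then 2 * (τ ⟨x, hxy⟩ : ℤ) - 1 else 2 * (τ ⟨a, ha⟩ : ℤ)
    have hy : h y = 2 * (τ ⟨x, hxy⟩ : ℤ) - 1 := dif_pos rfl
    have hne : ∀ a (ha : a ≠ y), h a = 2 * (τ ⟨a, ha⟩ : ℤ) := fun a ha => dif_neg ha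
    have hinj : Function.Injective h := by
      intro a b hab
      by_cases ha : a = y
      · by_cases hb : b = y
        · rw [ha, hb]
        · rw [ha, hy, hne b hb] at hab; omega
      · by_cases hb : b = y
        · rw [hb, hy, hne a ha] at hab; omega
        · rw [hne a ha, hne b hb] at hab
          have : τ ⟨a, ha⟩ = τ ⟨b, hb⟩ := Fin.ext (by omega)
          simpa using τ.injective this
    obtain ⟨f, hf⟩ := exists_equiv_fin_lt_iff_lt (Fintype.equivFinOfCardEq hα) hinj
    have hdel : deleteElt y f = τ := by
      refine equiv_fin_eq_of_lt_iff_lt fun a b => ?_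
      rw [deleteElt_lt_iff, hf, hne a a.2, hne b b.2]
      simp
    refine ⟨f, ⟨?_, ?_⟩, hdel⟩
    · rw [eq_add_one_iff_forall_not_between, hf, hy, hne x hxy]
      refine ⟨by omega, fun z => ?_⟩
      rw [hf, hf, hy, hne x hxy]
      by_cases hz : z = y
      · rw [hz, hy]; omega
      · rw [hne z hz]; omega
    · rw [hdel]; exact hτ

lemma card_ne_of_card_eq [Fintype α] [DecidableEq α] {y : α} (hα : Fintype.card α = m + 1) :
    Fintype.card {a // a ≠ y} = m := by
  rw [Fintype.card_subtype_compl, Fintype.card_subtype_eq, hα, Nat.add_sub_cancel]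

lemma ncard_adjacent_eq_factorial [Fintype α] {x y : α} (hxy : x ≠ y)
    (hα : Fintype.card α = m + 1) :
    {f : α ≃ Fin (m + 1) | (f x : ℕ) = f y + 1}.ncard = m.factorial := by
  classical
  rw [← ncard_univ_equiv_fin (card_ne_of_card_eq (y := y) hα),
    ← ncard_adjacent hxy hα]
  simp

lemma ncard_adjacent_adjacent_le [Fintype α] {M : ℕ} (hM : M = m + 2) {x y x' y' : α}
    (hα : Fintype.card α = M) (hxy : x ≠ y)
    (hxy' : x' ≠ y') (hx'y : x' ≠ y) (hy'y : y' ≠ y) :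
    {f : α ≃ Fin M | (f x : ℕ) = f y + 1 ∧ (f x' : ℕ) = f y' + 1}.ncard ≤ m.factorial := by
  classical
  subst hM
  rw [← ncard_adjacent_eq_factorial (x := ⟨x', hx'y⟩) (y := ⟨y', hy'y⟩)
    (by simpa using hxy') (card_ne_of_card_eq (y := y) hα), ← ncard_adjacent hxy hα]
  refine Set.ncard_le_ncard fun f hf => ?_
  simp only [Set.mem_ofPred_eq] at hf ⊢
  refine ⟨hf.1, ?_⟩
  have h := (eq_add_one_iff_forall_not_between f).1 hf.2
  rw [eq_add_one_iff_forall_not_between]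
  simp only [deleteElt_lt_iff]
  exact ⟨h.1, fun z => h.2 z⟩

variable {k : ℕ} {x y : Fin k → α}

/-- The number of orders compatible with all letters in which the new strip `t` is immediately
before the old strip `s`: only the letters `s` and `t` interact. -/
lemma ncard_adjacent_and_letterOrder [Fintype α] {M : ℕ} (hM : M = m + 1)
    (hα : Fintype.card α = M)
    (hx : Function.Injective x) (hy : Function.Injective y) (hxy : ∀ i j, x i ≠ y j)
    (u : Fin k → Letter) {s t : Fin k} (hst : s ≠ t) :
    6 * 2 ^ (k - 2) * {f : α ≃ Fin M | (∀ i, LetterOrder (u i) (f (x i)) (f (y i))) ∧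
      (f (x s) : ℕ) = f (y t) + 1}.ncard =
      (if u s = u t then 1 else 2) * m.factorial := by
  classical
  subst hM
  -- after merging `y t` with `x s`, the letter `t` relates `x t` to `x s`
  let X : Fin k → {a // a ≠ y t} := fun i => ⟨x i, hxy i t⟩
  let Y : Fin k → {a // a ≠ y t} := fun i =>
    if h : i = t then X s else ⟨y i, fun h' => h (hy h')⟩
  have hYt : Y t = X s := dif_pos rfl
  have hY : ∀ i, i ≠ t → (Y i : α) = y i := fun i hi => by
    simp only [Y, dif_neg hi]
  have hXinj : Function.Injective X := fun i j h => hx (congrArg Subtype.val h)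
  have hXY : ∀ i j, j ≠ t → X i ≠ Y j := fun i j hj h => hxy i j (by
    rw [← hY j hj, ← h])
  have hYinj : ∀ i j, i ≠ t → j ≠ t → Y i = Y j → i = j := fun i j hi hj h => hy (by
    rw [← hY i hi, ← hY j hj, h])
  have e1 : {f : α ≃ Fin (m + 1) | (∀ i, LetterOrder (u i) (f (x i)) (f (y i))) ∧
      (f (x s) : ℕ) = f (y t) + 1}.ncard =
      {τ : {a // a ≠ y t} ≃ Fin m | ∀ i, LetterOrder (u i) (τ (X i)) (τ (Y i))}.ncard := by
    rw [← ncard_adjacent (hxy s t) hα]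
    congr 1
    ext f
    simp only [Set.mem_ofPred_eq]
    rw [and_comm]
    refine and_congr_right fun hf => forall_congr' fun i => ?_
    simp only [LetterOrder, deleteElt_lt_iff]
    by_cases hi : i = t
    · subst hi
      have e1 := f.injective.ne (hx.ne hst)
      have e2 := f.injective.ne (hxy i i)
      rw [hYt]
      simp only [X]
      refine and_congr (imp_congr_right fun _ => ?_) (imp_congr_right fun _ => ?_) <;> omega
    · rw [hY i hi]
  have e2 : {τ : {a // a ≠ y t} ≃ Fin m | ∀ i, LetterOrder (u i) (τ (X i)) (τ (Y i))} =
      {τ : {a // a ≠ y t} ≃ Fin m |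
        (LetterOrder (u s) (τ (X s)) (τ (Y s)) ∧ LetterOrder (u t) (τ (X t)) (τ (X s))) ∧
        ∀ i ∈ (Finset.univ.erase s).erase t, LetterOrder (u i) (τ (X i)) (τ (Y i))} := by
    ext τ
    simp only [Set.mem_ofPred_eq, Finset.mem_univ, Finset.mem_erase, and_true]
    constructor
    · intro h
      refine ⟨⟨h s, ?_⟩, fun i _ => h i⟩
      have := h t
      rwa [hYt] at this
    · rintro ⟨⟨h1, h2⟩, h3⟩ i
      by_cases hi : i = t
      · subst hi; rw [hYt]; exact h2
      · by_cases hi' : i = s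
        · subst hi'; exact h1
        · exact h3 i ⟨hi, hi'⟩
  have hcard : ((Finset.univ.erase s).erase t : Finset (Fin k)).card = k - 2 := by
    rw [Finset.card_erase_of_mem (by simp [hst.symm]), Finset.card_erase_of_mem (by simp),
      Finset.card_univ, Fintype.card_fin]
    omega
  have hU : ∀ i ∈ (Finset.univ.erase s).erase t, i ≠ t ∧ i ≠ s := fun i hi => by simpa using hi
  rw [e1, e2, mul_assoc, ← hcard, two_pow_mul_ncard_letterOrder]
  · exact six_mul_ncard_letterOrder (card_ne_of_card_eq hα) (hXY s s hst) (hXinj.ne hst)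
      (hXY t s hst).symm _ _
  · exact fun i _ j hj => hXY i j (hU j hj).1
  · exact hXinj.injOn
  · exact fun i hi j hj h => hYinj i j (hU i hi).1 (hU j hj).1 h
  · intro i hi τ
    obtain ⟨hit, his⟩ := hU i hi
    have h1 := Equiv.swap_apply_of_ne_of_ne (hXinj.ne his.symm) (hXY s i hit)
    have h2 := Equiv.swap_apply_of_ne_of_ne (hXinj.ne hit.symm) (hXY t i hit)
    have h3 := Equiv.swap_apply_of_ne_of_ne (hXY i s hst).symm
      (fun h => his (hYinj s i hst hit h).symm)
    simp only [Equiv.trans_apply, h1, h2, h3]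

end Count

/-! ### Canonical orders to second order, and the comparison of two words -/

/-- A Bonferroni inequality with a uniform bound on the pairwise intersections. -/
lemma sum_ncard_le_ncard_biUnion_add {ι β : Type*} [Finite β] (I : Finset ι) (A : ι → Set β) (c : ℕ)
    (hA : ∀ i ∈ I, ∀ j ∈ I, i ≠ j → (A i ∩ A j).ncard ≤ c) :
    ∑ i ∈ I, (A i).ncard ≤ (⋃ i ∈ I, A i).ncard + I.card ^ 2 * c := by
  classical
  induction I using Finset.induction_on with
  | empty => simp
  | insert i I hi ih =>
    have h1 := ih fun a ha b hb => hA a (by simp [ha]) b (by simp [hb])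
    have h2 := Set.ncard_union_add_ncard_inter (A i) (⋃ j ∈ I, A j)
    have h3 : (A i ∩ ⋃ j ∈ I, A j).ncard ≤ I.card * c := by
      rw [Set.inter_iUnion₂]
      refine (Finset.set_ncard_biUnion_le I _).trans ?_
      rw [← smul_eq_mul]
      refine Finset.sum_le_card_nsmul _ _ _ fun j hj => hA i (by simp) j (by simp [hj]) ?_
      rintro rfl
      exact hi hj
    rw [Finset.sum_insert hi, Finset.set_biUnion_insert, Finset.card_insert_of_notMem hi]
    nlinarith

lemma oldStrip_injective (n k : ℕ) : Function.Injective (oldStrip n : Fin k → Fin (n + k)) :=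
  fun s t h => Fin.ext (by simpa using congrArg Fin.val h)

lemma newStrip_injective (n k : ℕ) : Function.Injective (newStrip n : Fin k → Fin (n + k)) :=
  fun s t h => Fin.ext (by simpa using congrArg Fin.val h)

lemma oldStrip_ne_newStrip {n k : ℕ} (hk : k ≤ n) (s t : Fin k) : oldStrip n s ≠ newStrip n t :=
  fun h => by
    have := congrArg Fin.val h
    simp only [val_oldStrip, val_newStrip] at this
    omega

lemma two_pow_mul_ncard_respectsLetters {n k : ℕ} (hk : k ≤ n) (u : Fin k → Letter) :
    2 ^ k * {σ : Equiv.Perm (Fin (n + k)) | RespectsLetters u σ}.ncard = (n + k).factorial := by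
  have := two_pow_mul_ncard_letterOrder (m := n + k) (α := Fin (n + k)) Finset.univ
    (x := oldStrip n) (y := newStrip n) u (fun i _ j _ => oldStrip_ne_newStrip hk i j)
    (oldStrip_injective n k).injOn (newStrip_injective n k).injOn (Φ := fun _ => True)
    fun _ _ _ => Iff.rfl
  rw [ncard_univ_equiv_fin (Fintype.card_fin _), Finset.card_univ, Fintype.card_fin] at this
  rw [← this]
  simp [RespectsLetters]

/-- The increasing pairs of positions in a word of length `k`. -/
def positionPairs (k : ℕ) : Finset (Fin k × Fin k) := Finset.univ.filter fun p => p.1 < p.2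

/-- The number of pairs of positions, those with distinct letters being counted twice. -/
def pairWeight {k : ℕ} (u : Fin k → Letter) : ℕ :=
  ∑ p ∈ positionPairs k, if u p.1 = u p.2 then 1 else 2

/-- The orders compatible with the letters that have `newStrip p.2` immediately before
`oldStrip p.1`. -/
def adjacentOrders (n : ℕ) {k : ℕ} (u : Fin k → Letter) (p : Fin k × Fin k) :
    Set (Equiv.Perm (Fin (n + k))) :=
  {σ | (∀ i, LetterOrder (u i) (σ (oldStrip n i)) (σ (newStrip n i))) ∧
    (σ (oldStrip n p.1) : ℕ) = σ (newStrip n p.2) + 1}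

lemma ncard_canonical_add {n k : ℕ} (u : Fin k → Letter) :
    {σ : Equiv.Perm (Fin (n + k)) | RespectsLetters u σ ∧ IsCanonical σ}.ncard +
      (⋃ p ∈ positionPairs k, adjacentOrders n u p).ncard =
    {σ : Equiv.Perm (Fin (n + k)) | RespectsLetters u σ}.ncard := by
  rw [← Set.ncard_union_eq]
  · congr 1
    ext σ
    simp only [Set.mem_union, Set.mem_ofPred_eq, Set.mem_iUnion, positionPairs, Finset.mem_filter,
      Finset.mem_univ, true_and, adjacentOrders, IsCanonical]
    constructor
    · rintro (h | ⟨p, -, h, -⟩)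
      exacts [h.1, h]
    · intro h
      by_cases hc : ∀ s t : Fin k, s < t → (σ (oldStrip n s) : ℕ) ≠ σ (newStrip n t) + 1
      · exact Or.inl ⟨h, hc⟩
      · push Not at hc
        obtain ⟨s, t, hst, he⟩ := hc
        exact Or.inr ⟨(s, t), hst, h, he⟩
  · refine Set.disjoint_left.2 fun σ hσ hσ' => ?_
    simp only [Set.mem_iUnion, positionPairs, Finset.mem_filter, Finset.mem_univ, true_and] at hσ'
    obtain ⟨p, hp, -, he⟩ := hσ'
    exact hσ.2 _ _ hp he

lemma mul_sum_ncard_adjacentOrders {n k m : ℕ} (hm : n + k = m + 1) (hk : k ≤ n)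
    (u : Fin k → Letter) :
    6 * 2 ^ (k - 2) * ∑ p ∈ positionPairs k, (adjacentOrders n u p).ncard =
      pairWeight u * m.factorial := by
  rw [Finset.mul_sum, pairWeight, Finset.sum_mul]
  refine Finset.sum_congr rfl fun p hp => ?_
  exact ncard_adjacent_and_letterOrder hm (Fintype.card_fin _) (oldStrip_injective n k)
    (newStrip_injective n k) (oldStrip_ne_newStrip hk) u
    (ne_of_lt (Finset.mem_filter.1 hp).2)

lemma ncard_adjacentOrders_inter_le {n k m : ℕ} (hm : n + k = m + 2) (hk : k ≤ n)
    (u : Fin k → Letter) {p q : Fin k × Fin k} (hpq : p ≠ q) :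
    (adjacentOrders n u p ∩ adjacentOrders n u q).ncard ≤ m.factorial := by
  by_cases h : q.2 = p.2
  · -- the strip that follows `newStrip p.2` would be both `oldStrip p.1` and `oldStrip q.1`
    have : adjacentOrders n u p ∩ adjacentOrders n u q = ∅ := by
      refine Set.eq_empty_of_forall_notMem fun σ hσ => hpq ?_
      have h1 := hσ.1.2
      have h2 := hσ.2.2
      rw [h, ← h1] at h2
      exact Prod.ext (oldStrip_injective n k (σ.injective (Fin.ext h2))).symm h.symm
    rw [this, Set.ncard_empty]
    exact Nat.zero_le _
  · refine le_trans (Set.ncard_le_ncard ?_) (ncard_adjacent_adjacent_le hm (Fintype.card_fin _)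
      (oldStrip_ne_newStrip hk p.1 p.2) (oldStrip_ne_newStrip hk q.1 q.2)
      (oldStrip_ne_newStrip hk q.1 p.2) ((newStrip_injective n k).ne h))
    exact fun σ hσ => ⟨hσ.1.2, hσ.2.2⟩

/-- The number of decompositions up to terms of relative order `n⁻²`: the word enters the second
term only through `pairWeight`. -/
lemma exists_ncard_BSD_add {w : List Letter} {n m : ℕ} (hm : n + w.length = m + 2)
    (hk : w.length ≤ n) :
    ∃ T U : ℕ, (BSD w n).ncard + U = T ∧ 2 ^ w.length * T = (n + w.length).factorial ∧
      6 * 2 ^ (w.length - 2) * U ≤ pairWeight w.get * (m + 1).factorial ∧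
      pairWeight w.get * (m + 1).factorial ≤
        6 * 2 ^ (w.length - 2) * (U + (positionPairs w.length).card ^ 2 * m.factorial) := by
  refine ⟨_, (⋃ p ∈ positionPairs w.length, adjacentOrders n w.get p).ncard, ?_,
    two_pow_mul_ncard_respectsLetters hk w.get, ?_, ?_⟩
  · rw [ncard_BSD (by omega) hk, ncard_canonical_add]
  · rw [← mul_sum_ncard_adjacentOrders (m := m + 1) hm hk]
    exact Nat.mul_le_mul_left _ (Finset.set_ncard_biUnion_le _ _)
  · rw [← mul_sum_ncard_adjacentOrders (m := m + 1) hm hk]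
    exact Nat.mul_le_mul_left _ (sum_ncard_le_ncard_biUnion_add _ _ _ fun p _ q _ hpq =>
      ncard_adjacentOrders_inter_le hm hk _ hpq)

/-- The contribution of a letter to `hor`. -/
def letterSign : Letter → ℤ
  | Letter.c => 1
  | Letter.r => -1

lemma sum_letterSign (w : List Letter) : ∑ t, letterSign (w.get t) = hor w := by
  induction w with
  | nil => simp [hor, numC, numR]
  | cons a w ih =>
    have : ∑ t, letterSign ((a :: w).get t) = letterSign a + ∑ t, letterSign (w.get t) :=
      Fin.sum_univ_succ (n := w.length) fun t => letterSign ((a :: w).get t)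
    rw [this, ih]
    cases a <;> simp [hor, numC, numR, letterSign] <;> ring

lemma sum_sum_eq_sum_diag_add {k : ℕ} {f : Fin k → Fin k → ℤ} (hf : ∀ s t, f s t = f t s) :
    ∑ s, ∑ t, f s t = ∑ t, f t t + 2 * ∑ p ∈ positionPairs k, f p.1 p.2 := by
  have h1 : ∑ p ∈ positionPairs k, f p.1 p.2 = ∑ s, ∑ t, if s < t then f s t else 0 := by
    rw [positionPairs, Finset.sum_filter, Fintype.sum_prod_type]
  have h2 : ∑ s, ∑ t, (if t < s then f s t else 0) = ∑ s, ∑ t, if s < t then f s t else 0 := by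
    rw [Finset.sum_comm]
    simp only [hf]
  have h3 : ∑ t, f t t = ∑ s, ∑ t, if s = t then f s t else 0 := by simp
  rw [two_mul, h1]
  nth_rewrite 2 [← h2]
  rw [h3, ← Finset.sum_add_distrib, ← Finset.sum_add_distrib]
  refine Finset.sum_congr rfl fun s _ => ?_
  rw [← Finset.sum_add_distrib, ← Finset.sum_add_distrib]
  refine Finset.sum_congr rfl fun t _ => ?_
  rcases lt_trichotomy s t with h | rfl | h
  · simp [h, h.ne, h.not_gt]
  · simp
  · simp [h, h.ne', h.not_gt]

/-- The weight is a decreasing function of the square of `hor w`. -/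
lemma four_mul_pairWeight (w : List Letter) :
    4 * (pairWeight w.get : ℤ) = 6 * (positionPairs w.length).card + w.length - hor w ^ 2 := by
  have h1 : 2 * (pairWeight w.get : ℤ) = ∑ p ∈ positionPairs w.length,
      (3 - letterSign (w.get p.1) * letterSign (w.get p.2)) := by
    rw [pairWeight]
    push_cast
    rw [Finset.mul_sum]
    refine Finset.sum_congr rfl fun p _ => ?_
    cases w.get p.1 <;> cases w.get p.2 <;> simp [letterSign]
  have h2 : hor w ^ 2 = w.length + 2 * ∑ p ∈ positionPairs w.length,
      letterSign (w.get p.1) * letterSign (w.get p.2) := by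
    have hsq : ∀ l, letterSign l * letterSign l = 1 := fun l => by cases l <;> simp [letterSign]
    rw [← sum_letterSign, pow_two, Finset.sum_mul_sum,
      sum_sum_eq_sum_diag_add fun s t => mul_comm _ _]
    simp [hsq]
  rw [Finset.sum_sub_distrib, Finset.sum_const, nsmul_eq_mul] at h1
  linarith

lemma pairWeight_lt {v w : List Letter} (hvw : v.length = w.length) (h : |hor v| < |hor w|) :
    pairWeight w.get < pairWeight v.get := by
  have h1 := four_mul_pairWeight v
  have h2 := four_mul_pairWeight w
  have h3 := sq_lt_sq.2 h
  generalize pairWeight v.get = a at *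
  rw [hvw] at h1
  omega

lemma two_le_length_of_abs_hor_lt {v w : List Letter} (hvw : v.length = w.length)
    (h : |hor v| < |hor w|) : 2 ≤ v.length := by
  have h1 := numC_add_numR v
  have h2 := numC_add_numR w
  simp only [hor] at h
  rcases abs_cases ((numC v : ℤ) - numR v) with h3 | h3 <;>
  rcases abs_cases ((numC w : ℤ) - numR w) with h4 | h4 <;> omega

/-- Two words of equal length have equal leading terms, so that their numbers of decompositions
are compared through the correction terms `U` and `U'`. -/
lemma exists_ncard_BSD_add_eq {v w : List Letter} {k n m : ℕ} (hv : v.length = k)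
    (hw : w.length = k) (hm : n + k = m + 2) (hk : k ≤ n) :
    ∃ U U' : ℕ, (BSD v n).ncard + U = (BSD w n).ncard + U' ∧
      U ≤ pairWeight v.get * (m + 1).factorial ∧ U' ≤ pairWeight w.get * (m + 1).factorial ∧
      6 * 2 ^ (k - 2) * U' ≤ pairWeight w.get * (m + 1).factorial ∧
      pairWeight v.get * (m + 1).factorial ≤
        6 * 2 ^ (k - 2) * (U + (positionPairs k).card ^ 2 * m.factorial) := by
  obtain ⟨T, U, h1, h2, h3, h4⟩ := exists_ncard_BSD_add (w := v) (by rwa [hv]) (by rwa [hv])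
  obtain ⟨T', U', h1', h2', h3', h4'⟩ := exists_ncard_BSD_add (w := w) (by rwa [hw]) (by rwa [hw])
  generalize pairWeight v.get = a at *
  generalize pairWeight w.get = b at *
  rw [hv] at h2 h3 h4
  rw [hw] at h2' h3' h4'
  have hT : T = T' := Nat.eq_of_mul_eq_mul_left (by positivity) (h2.trans h2'.symm)
  have hpos : 0 < 6 * 2 ^ (k - 2) := by positivity
  exact ⟨U, U', by omega, (Nat.le_mul_of_pos_left U hpos).trans h3,
    (Nat.le_mul_of_pos_left U' hpos).trans h3', h3', h4⟩

lemma factorial_le_mul_pow {k n : ℕ} (hk : 1 ≤ k) (hkn : k ≤ n) :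
    (n + k - 1).factorial ≤ (n - k).factorial * (2 * n) ^ (2 * k - 1) := by
  have h := Nat.factorial_mul_descFactorial (show 2 * k - 1 ≤ n + k - 1 by omega)
  rw [show n + k - 1 - (2 * k - 1) = n - k by omega] at h
  rw [← h]
  refine Nat.mul_le_mul_left _ ((Nat.descFactorial_le_pow _ _).trans ?_)
  exact Nat.pow_le_pow_left (by omega) _

lemma eventually_ncard_BSD_lt {k : ℕ} {v w : List Letter} (hv : v.length = k) (hw : w.length = k)
    (hvw : |hor v| < |hor w|) :
    ∀ᶠ n : ℕ in atTop, (BSD v n).ncard < (BSD w n).ncard := by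
  have hwt := pairWeight_lt (hv.trans hw.symm) hvw
  have hk2 : 2 ≤ k := hv ▸ two_le_length_of_abs_hor_lt (hv.trans hw.symm) hvw
  filter_upwards [eventually_ge_atTop (k + 6 * 2 ^ (k - 2) * (positionPairs k).card ^ 2)]
    with n hn
  obtain ⟨m, hm⟩ : ∃ m, n + k = m + 2 := ⟨n + k - 2, by omega⟩
  obtain ⟨U, U', h1, -, -, h2, h3⟩ := exists_ncard_BSD_add_eq hv hw hm (by omega)
  have h4 : (pairWeight w.get + 1) * (m + 1).factorial ≤ pairWeight v.get * (m + 1).factorial :=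
    Nat.mul_le_mul_right _ hwt
  have h5 : 6 * 2 ^ (k - 2) * (positionPairs k).card ^ 2 * m.factorial < (m + 1).factorial := by
    rw [Nat.factorial_succ]
    exact Nat.mul_lt_mul_of_pos_right (by omega) m.factorial_pos
  have h6 : U' < U := by
    by_contra h
    have : 6 * 2 ^ (k - 2) * U ≤ 6 * 2 ^ (k - 2) * U' := Nat.mul_le_mul_left _ (by omega)
    nlinarith
  omega

lemma isBigO_ncard_BSD_sub {k : ℕ} {v w : List Letter} (hv : v.length = k) (hw : w.length = k)
    (hvw : |hor v| < |hor w|) :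
    (fun n : ℕ => (((BSD v n).ncard : ℝ) - ((BSD w n).ncard : ℝ)) /
      ((n - k).factorial : ℝ)) =O[atTop] fun n : ℕ => (n : ℝ) ^ (2 * k - 1) := by
  have hk2 : 2 ≤ k := hv ▸ two_le_length_of_abs_hor_lt (hv.trans hw.symm) hvw
  refine IsBigO.of_bound (((pairWeight v.get + pairWeight w.get : ℕ) : ℝ) * 2 ^ (2 * k - 1)) ?_
  filter_upwards [eventually_ge_atTop k] with n hn
  obtain ⟨m, hm⟩ : ∃ m, n + k = m + 2 := ⟨n + k - 2, by omega⟩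
  obtain ⟨U, U', h1, h2, h3, -, -⟩ := exists_ncard_BSD_add_eq hv hw hm hn
  have h4 := factorial_le_mul_pow (by omega) hn
  rw [show n + k - 1 = m + 1 by omega] at h4
  have h5 : U + U' ≤ (pairWeight v.get + pairWeight w.get) *
      ((n - k).factorial * (2 * n) ^ (2 * k - 1)) := by
    refine le_trans ?_ (Nat.mul_le_mul_left _ h4)
    rw [add_mul]
    exact add_le_add h2 h3
  have hpos : (0 : ℝ) < ((n - k).factorial : ℝ) := by exact_mod_cast Nat.factorial_pos _
  rw [norm_div, Real.norm_of_nonneg hpos.le, div_le_iff₀ hpos,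
    Real.norm_of_nonneg (by positivity : (0 : ℝ) ≤ (n : ℝ) ^ (2 * k - 1)), Real.norm_eq_abs]
  have h1' : ((BSD v n).ncard : ℝ) + U = (BSD w n).ncard + U' := by exact_mod_cast h1
  have h5' : (U : ℝ) + U' ≤ ((pairWeight v.get + pairWeight w.get : ℕ) : ℝ) *
      ((n - k).factorial * (2 * n) ^ (2 * k - 1)) := by exact_mod_cast h5
  have hU : (0 : ℝ) ≤ U := Nat.cast_nonneg _
  have hU' : (0 : ℝ) ≤ U' := Nat.cast_nonneg _
  calc |((BSD v n).ncard : ℝ) - (BSD w n).ncard| ≤ U + U' := by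
        rw [abs_le]; constructor <;> linarith
    _ ≤ _ := h5'
    _ = _ := by rw [mul_pow]; ring

end BorderStrip

theorem mainTheorem4 (k : ℕ) (v w : List BorderStrip.Letter)
    (hv : v.length = k) (hw : w.length = k)
    (hvw : |BorderStrip.hor v| < |BorderStrip.hor w|) :
    (∀ᶠ n : ℕ in atTop, (BorderStrip.BSD v n).ncard < (BorderStrip.BSD w n).ncard) ∧
    ((fun n : ℕ => (((BorderStrip.BSD v n).ncard : ℝ) - ((BorderStrip.BSD w n).ncard : ℝ)) /
        ((n - k).factorial : ℝ)) =O[atTop] fun n : ℕ => (n : ℝ) ^ (2 * k - 1)) :=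
  ⟨BorderStrip.eventually_ncard_BSD_lt hv hw hvw, BorderStrip.isBigO_ncard_BSD_sub hv hw hvw⟩
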